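/- **Conventions.** A graph $A$ (in the sense of Serre) has vertex set $VA$, edge set $EA$, a fixed-point-free involution $e\mapsto e^{-1}$ on $EA$ and maps $o,t:EA\to VA$ with $o(e)=t(e^{-1})$. A graph of groups $\mathbb A$ on $A$ consists of groups $A_v$ ($v\in VA$), $A_e=A_{e^{-1}}$ ($e\in EA$) and monomorphisms $\alpha_e:A_e\to A_{o(e)}$, $\omega_e:A_e\to A_{t(e)}$ with $\alpha_{e^{-1}}=\omega_e$. An $\mathbb A$-path from $v$ to $v'$ is a sequence $a_0,e_1,a_1,\dots,e_k,a_k$ ($k\ge 0$) where $e_1,\dots,e_k$ is an edge-path from $v$ to $v'$, $a_0\in A_v$ and $a_i\in A_{t(e_i)}$. It is reduced if it has no subsequence $a,e,\omega_e(c),e^{-1},\bar a$ with $c\in A_e$. Let $\sim$ be the equivalence relation on $\mathbb A$-paths generated, modulo concatenation, by $a,e,\omega_e(c),e^{-1},\bar a\sim a\alpha_e(c)\bar a$. The group $\pi_1(\mathbb A,v_0)$ consists of the classes $\overline p$ of $\mathbb A$-paths $p$ from $v_0$ to $v_0$, multiplied by concatenation. The vertices of the Bass–Serre tree $\widetilde{(\mathbb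 A,v_0)}$ are the classes $\overline pA_v$, where $p$ is an $\mathbb A$-path from $v_0$ to a vertex $v$ and $\overline pA_v=\overline{p'}A_v$ if and only if $p\sim p'a$ for some $a\in A_v$; the vertex $\overline pA_v$ is adjacent to $\overline{pae}A_{t(e)}$ for $a\in A_v$, $o(e)=v$; the base vertex is $\overline 1A_{v_0}$; and $\pi_1(\mathbb A,v_0)$ acts by $\overline q\cdot\overline pA_v=\overline{qp}A_v$. An $\mathbb A$-graph $\mathcal B$ consists of a graph $B$, a graph morphism $[\,\cdot\,]:B\to A$, subgroups $B_u\le A_{[u]}$ for $u\in VB$, and elements $f_\alpha\in A_{[o(f)]}$, $f_\omega\in A_{[t(f)]}$ for $f\in EB$ with $(f^{-1})_\alpha=(f_\omega)^{-1}$. It defines a graph of groups $\mathbb B$ on $B$ with vertex groups $B_u$, edge groups $$B_f=\alpha_{[f]}^{-1}(f_\alpha^{-1}B_{o(f)}f_\alpha)\cap\omega_{[f]}^{-1}(f_\omega B_{t(f)}f_\omega^{-1})\le A_{[f]}$$ and boundary monomorphisms $g\mapsto f_\alpha\,\alpha_{[f]}(g)\,f_\alpha^{-1}$ and $g\mapsto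 f_\omega^{-1}\,\omega_{[f]}(g)\,f_\omega$. A $\mathbb B$-path $p=b_0,f_1,b_1,\dots,f_s,b_s$ from $u$ to $u'$ gives the $\mathbb A$-path $$\mu(p)=b_0(f_1)_\alpha,\,[f_1],\,(f_1)_\omega b_1(f_2)_\alpha,\,[f_2],\,\dots,\,[f_s],\,(f_s)_\omega b_s$$ from $[u]$ to $[u']$. For $u_0\in VB$ and $v_0=[u_0]$, $\mu$ induces a homomorphism $\nu:\pi_1(\mathbb B,u_0)\to\pi_1(\mathbb A,v_0)$ and a map of graphs $\phi:\widetilde{(\mathbb B,u_0)}\to\widetilde{(\mathbb A,v_0)}$, $\overline pB_u\mapsto\overline{\mu(p)}A_{[u]}$. Let $L(\mathcal B,u_0)$ be the set of all $\mu(p)$, where $p$ is a reduced $\mathbb B$-path from $u_0$ to $u_0$. $\mathcal B$ is folded if (1) there are no two distinct edges $f_1,f_2$ with the same initial vertex $z$ and the same type $e=[f_1]=[f_2]$ such that $(f_2)_\alpha=a'(f_1)_\alpha\alpha_e(c)$ for some $a'\in B_z$, $c\in A_e$; and (2) $\alpha_{[f]}^{-1}(f_\alpha^{-1}B_{o(f)}f_\alpha)=\omega_{[f]}^{-1}(f_\omega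 B_{t(f)}f_\omega^{-1})$ for every edge $f$ of $B$. **Proposition.** Let $\mathcal B$ be a folded $\mathbb A$-graph defining the graph of groups $\mathbb B$, let $u_0\in VB$ be a vertex of type $v_0=[u_0]$, let $G=\pi_1(\mathbb A,v_0)$, and let $U=\overline{L(\mathcal B,u_0)}$ be the set of $\sim$-classes of the elements of $L(\mathcal B,u_0)$. Then: 1. $U=\nu(\pi_1(\mathbb B,u_0))$, so $U$ is a subgroup of $G$. The homomorphism $\nu$ is injective, so $\nu:\pi_1(\mathbb B,u_0)\to U$ is an isomorphism. 2. The map $\phi:\widetilde{(\mathbb B,u_0)}\to\widetilde{(\mathbb A,v_0)}$ preserves the base vertices, is $\nu$-equivariant and is injective. 3. If the graph $B$ is connected, then $\mathbb B$, with the isomorphism $\nu:\pi_1(\mathbb B,u_0)\to U$, is an induced splitting of $U\le G$ with respect to the image $Y$ of $\phi$. That is, $Y$ is a $U$-invariant subtree of $\widetilde{(\mathbb A,v_0)}$ containing the base vertex, and $\mathbb B$ is the quotient graph of groups of the action of $U$ on $Y$, in the following sense. There are vertices $\tilde u\in VY$ ($u\in VB$), with $\tilde u_0$ the base vertex, and elements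 $\gamma_f\in U$ ($f\in EB$), with $\gamma_{f^{-1}}=\gamma_f^{-1}$ and with $\gamma_f=1$ for all $f$ in some maximal subtree of $B$, such that: * for each edge $f$ from $x$ to $y$ in $B$ there is an edge $\tilde f$ of $Y$ from $\tilde x$ to $\gamma_f\tilde y$; and $u\mapsto U\tilde u$, $f\mapsto U\tilde f$ are bijections from $VB$ and $EB$ onto the sets of $U$-orbits of vertices and of oriented edges of $Y$; * there are isomorphisms $\psi_u:B_u\to\mathrm{Stab}_U(\tilde u)$ and $\psi_f:B_f\to\mathrm{Stab}_U(\tilde f)$ under which, for $f$ from $x$ to $y$, the monomorphism $B_f\to B_x$ becomes the inclusion and $B_f\to B_y$ becomes $g\mapsto\gamma_f^{-1}g\gamma_f$; * $\nu(\overline p)=\psi(b_0)\gamma_{f_1}\psi(b_1)\cdots\gamma_{f_s}\psi(b_s)$ for every $\mathbb B$-path $p=b_0,f_1,b_1,\dots,f_s,b_s$ from $u_0$ to $u_0$, where each $\psi(b_i)$ is the image of $b_i$ under the $\psi_u$ of its vertex. -/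

import Mathlib

universe u v w₁ w₂ u' v'

/-- A graph in the sense of Serre with vertex set `V`. The edges with initial vertex `x` and terminal
vertex `y` form the type `x ⟶ y`, the inverse edge of `e` is `Quiver.reverse e`, and no edge equals
its inverse. (Only a loop could be equal to its inverse.) -/
class SerreGraph (V : Type u) extends Quiver.{v} V, Quiver.HasInvolutiveReverse V where
  reverse_ne : ∀ {x : V} (e : x ⟶ x), Quiver.reverse e ≠ e

/-- A graph of groups on the Serre graph `V`. The identification `A_e = A_{e⁻¹}` is the isomorphism
`bar e`; under it `α_{e⁻¹} = ω_e` and `ω_{e⁻¹} = α_e`. -/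
structure GraphOfGroups (V : Type u) [SerreGraph.{u, v} V] where
  vertexGroup : V → Type w₁
  [vertexGroup_group : ∀ x, Group (vertexGroup x)]
  edgeGroup : ∀ {x y : V}, (x ⟶ y) → Type w₂
  [edgeGroup_group : ∀ {x y : V} (e : x ⟶ y), Group (edgeGroup e)]
  α : ∀ {x y : V} (e : x ⟶ y), edgeGroup e →* vertexGroup x
  ω : ∀ {x y : V} (e : x ⟶ y), edgeGroup e →* vertexGroup y
  α_injective : ∀ {x y : V} (e : x ⟶ y), Function.Injective (α e)
  ω_injective : ∀ {x y : V} (e : x ⟶ y), Function.Injective (ω e)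
  bar : ∀ {x y : V} (e : x ⟶ y), edgeGroup e ≃* edgeGroup (Quiver.reverse e)
  α_bar : ∀ {x y : V} (e : x ⟶ y) (c : edgeGroup e), α (Quiver.reverse e) (bar e c) = ω e c
  ω_bar : ∀ {x y : V} (e : x ⟶ y) (c : edgeGroup e), ω (Quiver.reverse e) (bar e c) = α e c

attribute [instance] GraphOfGroups.vertexGroup_group GraphOfGroups.edgeGroup_group

namespace GraphOfGroups

variable {V : Type u} [SerreGraph.{u, v} V]

/-- `𝔸.Path x y` is the type of `𝔸`-paths `a₀, e₁, a₁, …, e_k, a_k` from `x` to `y`. -/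
inductive Path (𝔸 : GraphOfGroups.{u, v, w₁, w₂} V) : V → V → Type (max u v w₁)
  | nil {x : V} (a : 𝔸.vertexGroup x) : Path 𝔸 x x
  | cons {x y z : V} (a : 𝔸.vertexGroup x) (e : x ⟶ y) (p : Path 𝔸 y z) : Path 𝔸 x z

variable {𝔸 : GraphOfGroups.{u, v, w₁, w₂} V}

namespace Path

def length {x y : V} : 𝔸.Path x y → ℕ
  | nil _ => 0
  | cons _ _ p => p.length + 1

/-- Multiply the first group element of a path from the left. -/
def lmul {x y : V} (a : 𝔸.vertexGroup x) : 𝔸.Path x y → 𝔸.Path x y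
  | nil b => nil (a * b)
  | cons b e p => cons (a * b) e p

/-- Concatenation: the last element of `p` is multiplied with the first element of `q`. -/
def append {x y z : V} : 𝔸.Path x y → 𝔸.Path y z → 𝔸.Path x z
  | nil a, q => lmul a q
  | cons a e p, q => cons a e (p.append q)

/-- The path `a_k⁻¹, e_k⁻¹, …, e₁⁻¹, a₀⁻¹`. -/
def inv {x y : V} : 𝔸.Path x y → 𝔸.Path y x
  | nil a => nil a⁻¹
  | cons a e p => p.inv.append (cons 1 (Quiver.reverse e) (nil a⁻¹))

/-- The path `a, e, ω_e(c), e⁻¹, a'`. -/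
def backtrack {x y : V} (a : 𝔸.vertexGroup x) (e : x ⟶ y) (c : 𝔸.edgeGroup e)
    (a' : 𝔸.vertexGroup x) : 𝔸.Path x x :=
  cons a e (cons (𝔸.ω e c) (Quiver.reverse e) (nil a'))

/-- The equivalence relation `∼` on paths, generated modulo concatenation by
`a, e, ω_e(c), e⁻¹, a' ∼ a α_e(c) a'`. -/
inductive Homotopic : ∀ {x y : V}, 𝔸.Path x y → 𝔸.Path x y → Prop
  | refl {x y : V} (p : 𝔸.Path x y) : Homotopic p p
  | symm {x y : V} {p q : 𝔸.Path x y} : Homotopic p q → Homotopic q p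
  | trans {x y : V} {p q r : 𝔸.Path x y} : Homotopic p q → Homotopic q r → Homotopic p r
  | append {x y z : V} {p p' : 𝔸.Path x y} {q q' : 𝔸.Path y z} :
      Homotopic p p' → Homotopic q q' → Homotopic (p.append q) (p'.append q')
  | backtrack {x y : V} (a : 𝔸.vertexGroup x) (e : x ⟶ y) (c : 𝔸.edgeGroup e)
      (a' : 𝔸.vertexGroup x) : Homotopic (backtrack a e c a') (nil (a * 𝔸.α e c * a'))

/-- No elementary reduction applies to `p`: it contains no `a, e, ω_e(c), e⁻¹, a'`. -/
def IsReduced {x y : V} (p : 𝔸.Path x y) : Prop :=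
  ¬ ∃ (s t : V) (q : 𝔸.Path x s) (a : 𝔸.vertexGroup s) (e : s ⟶ t) (c : 𝔸.edgeGroup e)
    (a' : 𝔸.vertexGroup s) (r : 𝔸.Path s y), p = q.append ((backtrack a e c a').append r)

theorem lmul_nil {x : V} (a b : 𝔸.vertexGroup x) : lmul a (nil b) = nil (a * b) := rfl

theorem lmul_cons {x y z : V} (a b : 𝔸.vertexGroup x) (e : x ⟶ y) (p : 𝔸.Path y z) :
    lmul a (cons b e p) = cons (a * b) e p := rfl

theorem nil_append {x y : V} (a : 𝔸.vertexGroup x) (q : 𝔸.Path x y) :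
    (nil a).append q = lmul a q := rfl

theorem cons_append {x y z t : V} (a : 𝔸.vertexGroup x) (e : x ⟶ y) (p : 𝔸.Path y z)
    (q : 𝔸.Path z t) : (cons a e p).append q = cons a e (p.append q) := rfl

theorem lmul_one {x y : V} (p : 𝔸.Path x y) : lmul 1 p = p := by
  cases p <;> simp [lmul_nil, lmul_cons]

theorem lmul_lmul {x y : V} (a b : 𝔸.vertexGroup x) (p : 𝔸.Path x y) :
    lmul a (lmul b p) = lmul (a * b) p := by
  cases p <;> simp [lmul_nil, lmul_cons, mul_assoc]

theorem lmul_append {x y z : V} (a : 𝔸.vertexGroup x) (p : 𝔸.Path x y) (q : 𝔸.Path y z) :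
    (lmul a p).append q = lmul a (p.append q) := by
  cases p <;> simp [lmul_nil, lmul_cons, nil_append, cons_append, lmul_lmul]

theorem append_assoc {x y z t : V} (p : 𝔸.Path x y) (q : 𝔸.Path y z) (r : 𝔸.Path z t) :
    (p.append q).append r = p.append (q.append r) := by
  induction p with
  | nil a => simp [nil_append, cons_append, lmul_append]
  | cons a e p ih => simp [nil_append, cons_append, ih]

theorem append_nil_one {x y : V} (p : 𝔸.Path x y) : p.append (nil 1) = p := by
  induction p with
  | nil a => simp [nil_append, cons_append, lmul_nil, lmul_cons]
  | cons a e p ih => simp [nil_append, cons_append, ih]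

theorem length_lmul {x y : V} (a : 𝔸.vertexGroup x) (p : 𝔸.Path x y) :
    (lmul a p).length = p.length := by
  cases p <;> rfl

theorem length_append {x y z : V} (p : 𝔸.Path x y) (q : 𝔸.Path y z) :
    (p.append q).length = p.length + q.length := by
  induction p with
  | nil a => simp [nil_append, cons_append, length_lmul, length]
  | cons a e p ih => simp [nil_append, cons_append, ih, length]; omega

theorem Homotopic.length_mod {x y : V} {p q : 𝔸.Path x y} (h : Homotopic p q) :
    p.length % 2 = q.length % 2 := by
  induction h with
  | refl p => rfl
  | symm _ ih => exact ih.symm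
  | trans _ _ ih₁ ih₂ => exact ih₁.trans ih₂
  | append _ _ ih₁ ih₂ => simp only [length_append]; omega
  | backtrack a e c a' => simp [Path.backtrack, length]

theorem Homotopic.cons {x y z : V} (a : 𝔸.vertexGroup x) (e : x ⟶ y) {p q : 𝔸.Path y z}
    (h : Homotopic p q) : Homotopic (Path.cons a e p) (Path.cons a e q) := by
  have := Homotopic.append (Homotopic.refl (Path.cons a e (nil 1))) h
  simpa [nil_append, cons_append, lmul_one] using this

theorem Homotopic.lmul {x y : V} (a : 𝔸.vertexGroup x) {p q : 𝔸.Path x y}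
    (h : Homotopic p q) : Homotopic (lmul a p) (lmul a q) :=
  Homotopic.append (Homotopic.refl (nil a)) h

theorem append_inv {x y : V} (p : 𝔸.Path x y) : Homotopic (p.append p.inv) (nil 1) := by
  induction p with
  | nil a => simpa [nil_append, cons_append, inv, lmul_nil, lmul_cons] using Homotopic.refl _
  | cons a e p ih =>
    simp only [nil_append, cons_append, inv]
    rw [← append_assoc]
    refine ((Homotopic.append ih (Homotopic.refl _)).cons a e).trans ?_
    have := Homotopic.backtrack a e 1 a⁻¹
    simpa [Path.backtrack, nil_append, cons_append, lmul_nil, lmul_cons] using this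

theorem inv_append {x y : V} (p : 𝔸.Path x y) : Homotopic (p.inv.append p) (nil 1) := by
  induction p with
  | nil a => simpa [nil_append, cons_append, inv, lmul_nil, lmul_cons] using Homotopic.refl _
  | @cons x y z a e p ih =>
    simp only [inv, append_assoc]
    have h := Homotopic.append
      (Homotopic.backtrack (1 : 𝔸.vertexGroup y) (Quiver.reverse e) 1 1) (Homotopic.refl p)
    simp only [Path.backtrack, nil_append, cons_append, lmul_nil, lmul_cons, map_one, Quiver.reverse_reverse, mul_one, lmul_one] at h
    refine (Homotopic.append (Homotopic.refl p.inv) (q' := p) ?_).trans ih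
    simpa [nil_append, cons_append, lmul_nil, lmul_cons] using h

theorem Homotopic.inv {x y : V} {p q : 𝔸.Path x y} (h : Homotopic p q) :
    Homotopic p.inv q.inv := by
  have h₁ : Homotopic (p.inv.append (q.append q.inv)) p.inv := by
    simpa [append_nil_one] using Homotopic.append (Homotopic.refl p.inv) (append_inv q)
  have h₂ : Homotopic (p.inv.append (q.append q.inv)) q.inv := by
    rw [← append_assoc]
    have := Homotopic.append ((Homotopic.append (Homotopic.refl p.inv) h.symm).trans
      (inv_append p)) (Homotopic.refl q.inv)
    simpa [nil_append, cons_append, lmul_one] using this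
  exact h₁.symm.trans h₂

/-- The equivalence relation `∼`. -/
instance homotopySetoid (𝔸 : GraphOfGroups.{u, v, w₁, w₂} V) (x y : V) : Setoid (𝔸.Path x y) where
  r := Homotopic
  iseqv := ⟨Homotopic.refl, Homotopic.symm, Homotopic.trans⟩

/-- The relation `p ∼ p' a` for some `a` in the vertex group of the common terminal vertex. -/
def cosetSetoid (𝔸 : GraphOfGroups.{u, v, w₁, w₂} V) (x y : V) : Setoid (𝔸.Path x y) where
  r p p' := ∃ a : 𝔸.vertexGroup y, Homotopic p (p'.append (nil a))
  iseqv := by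
    refine ⟨fun p => ⟨1, by rw [append_nil_one]; exact .refl p⟩, ?_, ?_⟩
    · rintro p q ⟨a, h⟩
      refine ⟨a⁻¹, ?_⟩
      have := Homotopic.append h.symm (Homotopic.refl (nil a⁻¹))
      rw [append_assoc] at this
      simpa [nil_append, cons_append, lmul_nil, lmul_cons, append_nil_one] using this
    · rintro p q r ⟨a, h⟩ ⟨b, h'⟩
      refine ⟨b * a, h.trans ?_⟩
      have := Homotopic.append h' (Homotopic.refl (nil a))
      rw [append_assoc] at this
      simpa [nil_append, cons_append, lmul_nil, lmul_cons] using this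

end Path

open GraphOfGroups.Path

/-- The fundamental group `π₁(𝔸, v₀)`: the set of `∼`-classes of paths from `v₀` to `v₀`. -/
def FundamentalGroup (𝔸 : GraphOfGroups.{u, v, w₁, w₂} V) (v₀ : V) : Type (max u v w₁) :=
  Quotient (homotopySetoid 𝔸 v₀ v₀)

namespace FundamentalGroup

/-- The `∼`-class of a closed path. -/
def mk {v₀ : V} (p : 𝔸.Path v₀ v₀) : FundamentalGroup 𝔸 v₀ := Quotient.mk _ p

/-- Multiplication is induced by concatenation. -/
instance (v₀ : V) : Group (FundamentalGroup 𝔸 v₀) where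
  mul := Quotient.map₂ Path.append fun _ _ h _ _ h' => Homotopic.append h h'
  one := mk (nil 1)
  inv := Quotient.map Path.inv fun _ _ h => Homotopic.inv h
  mul_assoc := by
    rintro ⟨p⟩ ⟨q⟩ ⟨r⟩
    exact congrArg mk (append_assoc p q r)
  one_mul := by
    rintro ⟨p⟩
    exact congrArg mk (lmul_one p)
  mul_one := by
    rintro ⟨p⟩
    exact congrArg mk (append_nil_one p)
  inv_mul_cancel := by
    rintro ⟨p⟩
    exact Quotient.sound (inv_append p)

end FundamentalGroup

/-- Vertices of the Bass–Serre tree: classes `p̄ A_y` of paths `p` from `v₀` to some vertex `y`. -/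
def TreeVertex (𝔸 : GraphOfGroups.{u, v, w₁, w₂} V) (v₀ : V) : Type (max u v w₁) :=
  Σ y : V, Quotient (cosetSetoid 𝔸 v₀ y)

namespace TreeVertex

/-- The vertex `p̄ A_y`. -/
def mk {v₀ y : V} (p : 𝔸.Path v₀ y) : TreeVertex 𝔸 v₀ := ⟨y, Quotient.mk _ p⟩

/-- The base vertex `1̄ A_{v₀}`. -/
def base (𝔸 : GraphOfGroups.{u, v, w₁, w₂} V) (v₀ : V) : TreeVertex 𝔸 v₀ := mk (nil 1)

theorem mk_append_nil {v₀ y : V} (p : 𝔸.Path v₀ y) (a : 𝔸.vertexGroup y) :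
    mk (p.append (nil a)) = mk p :=
  congrArg (Sigma.mk y) (Quotient.sound ⟨a, .refl _⟩)

theorem mk_eq_of_homotopic {v₀ y : V} {p q : 𝔸.Path v₀ y} (h : Homotopic p q) : mk p = mk q :=
  congrArg (Sigma.mk y) (Quotient.sound ⟨1, by rw [append_nil_one]; exact h⟩)

/-- Auxiliary: the parity of the distance to the base vertex. -/
def parity {v₀ : V} (s : TreeVertex 𝔸 v₀) : ℕ :=
  Quotient.lift (s := cosetSetoid 𝔸 v₀ s.1) (fun p => p.length % 2) (by
    rintro p q ⟨a, h⟩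
    simpa [length_append, length] using h.length_mod) s.2

/-- The action `q̄ · p̄ A_y = \overline{qp} A_y`. -/
instance (v₀ : V) : MulAction (FundamentalGroup 𝔸 v₀) (TreeVertex 𝔸 v₀) where
  smul g s := ⟨s.1, Quotient.map₂ (sa := homotopySetoid 𝔸 v₀ v₀) (sb := cosetSetoid 𝔸 v₀ s.1)
    (sc := cosetSetoid 𝔸 v₀ s.1) Path.append (by
      rintro q q' h p p' ⟨a, h'⟩
      refine ⟨a, ?_⟩
      rw [append_assoc]
      exact Homotopic.append h h') g s.2⟩
  one_smul := by
    rintro ⟨y, ⟨p⟩⟩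
    exact congrArg mk (lmul_one p)
  mul_smul := by
    rintro ⟨q⟩ ⟨q'⟩ ⟨y, ⟨p⟩⟩
    exact congrArg mk (append_assoc q q' p)

/-- `s = p̄ A_x` and `t = \overline{p a e} A_y` for some path `p` from `v₀` to `x`, some `a ∈ A_x` and
some edge `e` from `x` to `y`. -/
def Adj {v₀ : V} (s t : TreeVertex 𝔸 v₀) : Prop :=
  ∃ (x y : V) (p : 𝔸.Path v₀ x) (a : 𝔸.vertexGroup x) (e : x ⟶ y),
    s = mk p ∧ t = mk (p.append (cons a e (nil 1)))

theorem Adj.symm {v₀ : V} {s t : TreeVertex 𝔸 v₀} (h : Adj s t) : Adj t s := by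
  obtain ⟨x, y, p, a, e, rfl, rfl⟩ := h
  refine ⟨y, x, _, 1, Quiver.reverse e, rfl, ?_⟩
  have h : Homotopic ((p.append (cons a e (nil 1))).append (cons 1 (Quiver.reverse e) (nil 1)))
      (p.append (nil a)) := by
    rw [append_assoc]
    refine Homotopic.append (.refl p) ?_
    have := Homotopic.backtrack a e 1 1
    simpa [Path.backtrack, nil_append, cons_append, lmul_nil, lmul_cons] using this
  exact ((mk_eq_of_homotopic h).trans (mk_append_nil p a)).symm

theorem Adj.ne {v₀ : V} {s t : TreeVertex 𝔸 v₀} (h : Adj s t) : s ≠ t := by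
  obtain ⟨x, y, p, a, e, rfl, rfl⟩ := h
  intro h
  have := congrArg parity h
  simp only [parity, mk, Quotient.lift_mk, length_append, length] at this
  omega

end TreeVertex

/-- The Bass–Serre covering tree of `(𝔸, v₀)`. -/
def tree (𝔸 : GraphOfGroups.{u, v, w₁, w₂} V) (v₀ : V) : SimpleGraph (TreeVertex 𝔸 v₀) where
  Adj := TreeVertex.Adj
  symm := ⟨fun _ _ h => h.symm⟩
  loopless := ⟨fun _ h => h.ne rfl⟩

/-- Transport of edge groups along an equality of edges. -/
def edgeCongr (𝔸 : GraphOfGroups.{u, v, w₁, w₂} V) {x y : V} {e e' : x ⟶ y} (h : e = e') :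
    𝔸.edgeGroup e ≃* 𝔸.edgeGroup e' := by
  subst h
  exact MulEquiv.refl _

theorem α_edgeCongr {x y : V} {e e' : x ⟶ y} (h : e = e') (c : 𝔸.edgeGroup e) :
    𝔸.α e' (𝔸.edgeCongr h c) = 𝔸.α e c := by
  subst h
  rfl

theorem ω_edgeCongr {x y : V} {e e' : x ⟶ y} (h : e = e') (c : 𝔸.edgeGroup e) :
    𝔸.ω e' (𝔸.edgeCongr h c) = 𝔸.ω e c := by
  subst h
  rfl

end GraphOfGroups

open GraphOfGroups GraphOfGroups.Path

/-- An `𝔸`-graph with underlying graph `B`: `type` is the graph morphism `[·] : B → A`, `grp z` is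
the subgroup `B_z ≤ A_{[z]}`, and an edge `f` has the label `(fα f, [f], fω f)`. -/
structure AGraph {V : Type u} [SerreGraph.{u, v} V] (𝔸 : GraphOfGroups.{u, v, w₁, w₂} V)
    (B : Type u') [SerreGraph.{u', v'} B] where
  type : B ⥤q V
  type_reverse : ∀ {x y : B} (f : x ⟶ y),
    type.map (Quiver.reverse f) = Quiver.reverse (type.map f)
  grp : ∀ z : B, Subgroup (𝔸.vertexGroup (type.obj z))
  fα : ∀ {x y : B}, (x ⟶ y) → 𝔸.vertexGroup (type.obj x)
  fω : ∀ {x y : B}, (x ⟶ y) → 𝔸.vertexGroup (type.obj y)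
  fα_reverse : ∀ {x y : B} (f : x ⟶ y), fα (Quiver.reverse f) = (fω f)⁻¹

namespace AGraph

variable {V : Type u} [SerreGraph.{u, v} V] {𝔸 : GraphOfGroups.{u, v, w₁, w₂} V}
  {B : Type u'} [SerreGraph.{u', v'} B] (𝓑 : AGraph 𝔸 B)

theorem fω_reverse {x y : B} (f : x ⟶ y) : 𝓑.fω (Quiver.reverse f) = (𝓑.fα f)⁻¹ := by
  have := 𝓑.fα_reverse (Quiver.reverse f)
  rw [Quiver.reverse_reverse] at this
  rw [this, inv_inv]

/-- The map `c ↦ f_α α_{[f]}(c) f_α⁻¹` on `A_{[f]}`. -/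
def conjα {x y : B} (f : x ⟶ y) :
    𝔸.edgeGroup (𝓑.type.map f) →* 𝔸.vertexGroup (𝓑.type.obj x) :=
  (MulAut.conj (𝓑.fα f)).toMonoidHom.comp (𝔸.α (𝓑.type.map f))

/-- The map `c ↦ f_ω⁻¹ ω_{[f]}(c) f_ω` on `A_{[f]}`. -/
def conjω {x y : B} (f : x ⟶ y) :
    𝔸.edgeGroup (𝓑.type.map f) →* 𝔸.vertexGroup (𝓑.type.obj y) :=
  (MulAut.conj (𝓑.fω f)⁻¹).toMonoidHom.comp (𝔸.ω (𝓑.type.map f))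

/-- The subgroup `α_{[f]}⁻¹(f_α⁻¹ B_{o(f)} f_α)` of `A_{[f]}`. -/
def preα {x y : B} (f : x ⟶ y) : Subgroup (𝔸.edgeGroup (𝓑.type.map f)) :=
  (𝓑.grp x).comap (𝓑.conjα f)

/-- The subgroup `ω_{[f]}⁻¹(f_ω B_{t(f)} f_ω⁻¹)` of `A_{[f]}`. -/
def preω {x y : B} (f : x ⟶ y) : Subgroup (𝔸.edgeGroup (𝓑.type.map f)) :=
  (𝓑.grp y).comap (𝓑.conjω f)

/-- The edge group `B_f`. -/
def edgeGrp {x y : B} (f : x ⟶ y) : Subgroup (𝔸.edgeGroup (𝓑.type.map f)) :=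
  𝓑.preα f ⊓ 𝓑.preω f

/-- The identification `A_{[f]} = A_{[f⁻¹]}`. -/
def barType {x y : B} (f : x ⟶ y) :
    𝔸.edgeGroup (𝓑.type.map f) ≃* 𝔸.edgeGroup (𝓑.type.map (Quiver.reverse f)) :=
  (𝔸.bar (𝓑.type.map f)).trans (𝔸.edgeCongr (𝓑.type_reverse f).symm)

theorem conjα_barType {x y : B} (f : x ⟶ y) (c : 𝔸.edgeGroup (𝓑.type.map f)) :
    𝓑.conjα (Quiver.reverse f) (𝓑.barType f c) = 𝓑.conjω f c := by
  simp [conjα, conjω, barType, α_edgeCongr, 𝔸.α_bar, 𝓑.fα_reverse]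

theorem conjω_barType {x y : B} (f : x ⟶ y) (c : 𝔸.edgeGroup (𝓑.type.map f)) :
    𝓑.conjω (Quiver.reverse f) (𝓑.barType f c) = 𝓑.conjα f c := by
  simp [conjα, conjω, barType, ω_edgeCongr, 𝔸.ω_bar, 𝓑.fω_reverse]

theorem edgeGrp_reverse {x y : B} (f : x ⟶ y) :
    (𝓑.edgeGrp f).map (𝓑.barType f).toMonoidHom = 𝓑.edgeGrp (Quiver.reverse f) := by
  ext d
  obtain ⟨c, rfl⟩ := (𝓑.barType f).surjective d
  simp [edgeGrp, preα, preω, conjα_barType, conjω_barType, and_comm]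

/-- The graph of groups `𝔹` defined by the `𝔸`-graph `𝓑`. -/
def graphOfGroups : GraphOfGroups.{u', v', w₁, w₂} B where
  vertexGroup z := 𝓑.grp z
  edgeGroup f := 𝓑.edgeGrp f
  α f := ((𝓑.conjα f).comp (𝓑.edgeGrp f).subtype).codRestrict _ fun c => c.2.1
  ω f := ((𝓑.conjω f).comp (𝓑.edgeGrp f).subtype).codRestrict _ fun c => c.2.2
  α_injective f c d h := by
    have h := congrArg Subtype.val h
    exact Subtype.ext (𝔸.α_injective _ ((MulAut.conj (𝓑.fα f)).injective h))
  ω_injective f c d h := by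
    have h := congrArg Subtype.val h
    exact Subtype.ext (𝔸.ω_injective _ ((MulAut.conj (𝓑.fω f)⁻¹).injective h))
  bar f := ((𝓑.barType f).subgroupMap (𝓑.edgeGrp f)).trans
    (MulEquiv.subgroupCongr (𝓑.edgeGrp_reverse f))
  α_bar f c := Subtype.ext (𝓑.conjα_barType f c)
  ω_bar f c := Subtype.ext (𝓑.conjω_barType f c)

/-- The inclusion `B_z ≤ A_{[z]}`. -/
def incl (z : B) : 𝓑.graphOfGroups.vertexGroup z →* 𝔸.vertexGroup (𝓑.type.obj z) :=
  (𝓑.grp z).subtype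

/-- The inclusion `B_f ≤ A_{[f]}`. -/
def inclEdge {x y : B} (f : x ⟶ y) :
    𝓑.graphOfGroups.edgeGroup f →* 𝔸.edgeGroup (𝓑.type.map f) :=
  (𝓑.edgeGrp f).subtype

theorem incl_α {x y : B} (f : x ⟶ y) (c : 𝓑.graphOfGroups.edgeGroup f) :
    𝓑.incl x (𝓑.graphOfGroups.α f c) =
      𝓑.fα f * 𝔸.α (𝓑.type.map f) (𝓑.inclEdge f c) * (𝓑.fα f)⁻¹ := rfl

theorem incl_ω {x y : B} (f : x ⟶ y) (c : 𝓑.graphOfGroups.edgeGroup f) :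
    𝓑.incl y (𝓑.graphOfGroups.ω f c) =
      (𝓑.fω f)⁻¹ * 𝔸.ω (𝓑.type.map f) (𝓑.inclEdge f c) * 𝓑.fω f := by
  have h : 𝓑.incl y (𝓑.graphOfGroups.ω f c) =
      (𝓑.fω f)⁻¹ * 𝔸.ω (𝓑.type.map f) (𝓑.inclEdge f c) * (𝓑.fω f)⁻¹⁻¹ := rfl
  rw [h, inv_inv]

/-- The `𝔸`-path `μ(p) = b₀g₁, e₁, k₁b₁g₂, e₂, …, e_s, k_s b_s` of the `𝔹`-path
`p = b₀, f₁, b₁, …, f_s, b_s`, where `f_i` has the label `(g_i, e_i, k_i)`. -/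
def μ {x y : B} : 𝓑.graphOfGroups.Path x y → 𝔸.Path (𝓑.type.obj x) (𝓑.type.obj y)
  | nil b => nil (𝓑.incl _ b)
  | cons b f p => cons (𝓑.incl _ b * 𝓑.fα f) (𝓑.type.map f) (lmul (𝓑.fω f) (μ p))

theorem μ_nil {x : B} (b : 𝓑.graphOfGroups.vertexGroup x) : 𝓑.μ (nil b) = nil (𝓑.incl x b) := rfl

theorem μ_cons {x y z : B} (b : 𝓑.graphOfGroups.vertexGroup x) (f : x ⟶ y)
    (p : 𝓑.graphOfGroups.Path y z) : 𝓑.μ (cons b f p) =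
      cons (𝓑.incl x b * 𝓑.fα f) (𝓑.type.map f) (lmul (𝓑.fω f) (𝓑.μ p)) := rfl

theorem μ_lmul {x y : B} (b : 𝓑.graphOfGroups.vertexGroup x) (p : 𝓑.graphOfGroups.Path x y) :
    𝓑.μ (lmul b p) = lmul (𝓑.incl x b) (𝓑.μ p) := by
  cases p <;> simp [lmul_nil, lmul_cons, μ_nil, μ_cons, mul_assoc]

theorem μ_append {x y z : B} (p : 𝓑.graphOfGroups.Path x y) (q : 𝓑.graphOfGroups.Path y z) :
    𝓑.μ (p.append q) = (𝓑.μ p).append (𝓑.μ q) := by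
  induction p with
  | nil a => exact 𝓑.μ_lmul a q
  | cons a f p ih => simp [μ_cons, cons_append, ih, lmul_append]

theorem μ_homotopic {x y : B} {p q : 𝓑.graphOfGroups.Path x y} (h : Homotopic p q) :
    Homotopic (𝓑.μ p) (𝓑.μ q) := by
  induction h with
  | refl p => exact .refl _
  | symm _ ih => exact ih.symm
  | trans _ _ ih₁ ih₂ => exact ih₁.trans ih₂
  | append _ _ ih₁ ih₂ => simpa only [μ_append] using ih₁.append ih₂
  | @backtrack x y a f c a' =>
    have h := Homotopic.backtrack (𝓑.incl x a * 𝓑.fα f) (𝓑.type.map f) (𝓑.inclEdge f c)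
      ((𝓑.fα f)⁻¹ * 𝓑.incl x a')
    simpa [backtrack, μ_nil, μ_cons, lmul_nil, lmul_cons, incl_α, incl_ω, 𝓑.type_reverse,
      𝓑.fα_reverse, 𝓑.fω_reverse, mul_assoc] using h

/-- The language `L(𝓑, u₀)`. -/
def language (u₀ : B) : Set (𝔸.Path (𝓑.type.obj u₀) (𝓑.type.obj u₀)) :=
  {q | ∃ p : 𝓑.graphOfGroups.Path u₀ u₀, p.IsReduced ∧ q = 𝓑.μ p}

/-- The homomorphism `ν : π₁(𝔹, u₀) → π₁(𝔸, [u₀])` induced by `μ`. -/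
def ν (u₀ : B) :
    FundamentalGroup 𝓑.graphOfGroups u₀ →* FundamentalGroup 𝔸 (𝓑.type.obj u₀) where
  toFun := Quotient.map 𝓑.μ fun _ _ h => 𝓑.μ_homotopic h
  map_one' := rfl
  map_mul' := by
    rintro ⟨p⟩ ⟨q⟩
    exact congrArg FundamentalGroup.mk (𝓑.μ_append p q)

/-- The map `p̄ B_y ↦ \overline{μ(p)} A_{[y]}` on the vertices of the Bass–Serre trees. -/
def φVertex (u₀ : B) (s : TreeVertex 𝓑.graphOfGroups u₀) : TreeVertex 𝔸 (𝓑.type.obj u₀) :=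
  ⟨𝓑.type.obj s.1, Quotient.map (sa := cosetSetoid _ _ _) (sb := cosetSetoid _ _ _) 𝓑.μ (by
    rintro p q ⟨b, h⟩
    exact ⟨𝓑.incl _ b, by simpa [μ_append, μ_nil] using 𝓑.μ_homotopic h⟩) s.2⟩

/-- The map `φ` of Bass–Serre trees. -/
def φ (u₀ : B) : tree 𝓑.graphOfGroups u₀ →g tree 𝔸 (𝓑.type.obj u₀) where
  toFun := 𝓑.φVertex u₀
  map_rel' := by
    rintro s t ⟨x, y, p, b, f, rfl, rfl⟩
    refine ⟨_, _, 𝓑.μ p, 𝓑.incl x b * 𝓑.fα f, 𝓑.type.map f, rfl, ?_⟩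
    refine Eq.trans (b := TreeVertex.mk (𝓑.μ (p.append (cons b f (nil 1))))) rfl ?_
    rw [← TreeVertex.mk_append_nil ((𝓑.μ p).append _) (𝓑.fω f), append_assoc, μ_append]
    simp [μ_cons, μ_nil, nil_append, cons_append, lmul_nil]

/-- `𝓑` is folded: neither of the two conditions that make it not folded applies. -/
def IsFolded : Prop :=
  ¬ ((∃ (z : B) (f₁ f₂ : Quiver.Star z), f₁ ≠ f₂ ∧ 𝓑.type.star z f₁ = 𝓑.type.star z f₂ ∧
        ∃ a' ∈ 𝓑.grp z, ∃ c : 𝔸.edgeGroup (𝓑.type.map f₁.2),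
          𝓑.fα f₂.2 = a' * 𝓑.fα f₁.2 * 𝔸.α (𝓑.type.map f₁.2) c) ∨
      (∃ (x y : B) (f : x ⟶ y), 𝓑.preα f ≠ 𝓑.preω f))

end AGraph

namespace GraphOfGroups

variable {V : Type u} [SerreGraph.{u, v} V] {𝔸 : GraphOfGroups.{u, v, w₁, w₂} V} {v₀ : V}
  {B : Type u'} [SerreGraph.{u', v'} B]

/-- The element `b₀ γ_{f₁} b₁ ⋯ γ_{f_s} b_s` of a group `U`, for elements `γ_f` of `U` and
homomorphisms from the vertex groups to `U`. -/
def Path.eval {𝔹 : GraphOfGroups.{u', v', w₁, w₂} B} {U : Type*} [Group U]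
    (γ : ∀ {x y : B}, (x ⟶ y) → U) (ψ : ∀ z : B, 𝔹.vertexGroup z →* U) {x y : B} :
    𝔹.Path x y → U
  | nil b => ψ _ b
  | cons b f p => ψ _ b * γ f * Path.eval γ ψ p

/-- The graph of groups `𝔹` with base vertex `u₀`, together with the map `κ : π₁(𝔹, u₀) → U`, is
the induced splitting of the subgroup `U` of `π₁(𝔸, v₀)` with respect to the `U`-invariant subtree
`Y` of the Bass–Serre tree of `(𝔸, v₀)`: the quotient graph of groups of the action of `U` on `Y`,
constructed from a lift of a maximal subtree of `Y/U` to `Y`.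

* A vertex `z` of `B` is lifted to a vertex `vLift z` of `Y`, and an edge `f` from `x` to `y` to the
  edge from `vLift x` to `γ f • vLift y`. This gives bijections of the vertices and of the edges of
  `B` with the `U`-orbits of vertices and of oriented edges of `Y`; on a maximal subtree of `B` the
  elements `γ f` are trivial, so that the lifts form a subtree of `Y`.
* The vertex groups are the stabilizers of the lifted vertices and the edge groups the stabilizers
  of the lifted edges. The map `α_f` is the inclusion and `ω_f` is `g ↦ (γ f)⁻¹ g (γ f)`.
* `κ` is the canonical isomorphism. -/
structure InducedSplitting (U : Subgroup (FundamentalGroup 𝔸 v₀)) (Y : (tree 𝔸 v₀).Subgraph)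
    (𝔹 : GraphOfGroups.{u', v', w₁, w₂} B) (u₀ : B) (κ : FundamentalGroup 𝔹 u₀ →* U) where
  base_mem : TreeVertex.base 𝔸 v₀ ∈ Y.verts
  smul_mem : ∀ (g : U) (s : TreeVertex 𝔸 v₀), s ∈ Y.verts → g • s ∈ Y.verts
  smul_adj : ∀ (g : U) (s t : TreeVertex 𝔸 v₀), Y.Adj s t → Y.Adj (g • s) (g • t)
  isTree : Y.coe.IsTree
  vLift : B → TreeVertex 𝔸 v₀
  vLift_mem : ∀ z, vLift z ∈ Y.verts
  vLift_base : vLift u₀ = TreeVertex.base 𝔸 v₀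
  vertex_orbits : ∀ s ∈ Y.verts, ∃! z : B, ∃ g : U, g • vLift z = s
  γ : ∀ {x y : B}, (x ⟶ y) → U
  γ_reverse : ∀ {x y : B} (f : x ⟶ y), γ (Quiver.reverse f) = (γ f)⁻¹
  edge_adj : ∀ {x y : B} (f : x ⟶ y), Y.Adj (vLift x) (γ f • vLift y)
  edge_orbits : ∀ s t, Y.Adj s t → ∃! f : Quiver.Total B,
    ∃ g : U, g • vLift f.left = s ∧ g • γ f.hom • vLift f.right = t
  maxTree : WideSubquiver B
  maxTree_isTree : Nonempty (Quiver.Arborescence maxTree)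
  γ_maxTree : ∀ {x y : B} (f : x ⟶ y), f ∈ maxTree x y → γ f = 1
  ψ : ∀ z : B, 𝔹.vertexGroup z ≃* MulAction.stabilizer U (vLift z)
  ψEdge : ∀ {x y : B} (f : x ⟶ y), 𝔹.edgeGroup f ≃*
    (MulAction.stabilizer U (vLift x) ⊓ MulAction.stabilizer U (γ f • vLift y) : Subgroup U)
  ψ_α : ∀ {x y : B} (f : x ⟶ y) (c : 𝔹.edgeGroup f), (ψ x (𝔹.α f c) : U) = ψEdge f c
  ψ_ω : ∀ {x y : B} (f : x ⟶ y) (c : 𝔹.edgeGroup f),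
    (ψ y (𝔹.ω f c) : U) = (γ f)⁻¹ * ψEdge f c * γ f
  κ_bijective : Function.Bijective κ
  κ_mk : ∀ p : 𝔹.Path u₀ u₀, κ (FundamentalGroup.mk p) =
    p.eval γ fun z => (MulAction.stabilizer U (vLift z)).subtype.comp (ψ z).toMonoidHom

end GraphOfGroups

/-! Everything rests on one fact: for a folded `𝓑`, the map `μ` sends reduced paths to reduced paths
(`IsFolded.isReduced_μ`). A backtrack `f, b, f'` in the image forces `f' = f⁻¹` by the first folding
condition, and by the second the edge-group element involved lies in `B_f`, so the backtrack was
already present in the `𝔹`-path.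

To exploit this, reduced paths must be the shortest in their class. This comes from normal forms, by
van der Waerden's method: paths act on normal forms, homotopic paths act equally, and a reduced path
keeps its length when normalized (`Homotopic.normalAct_eq`, `IsReduced.normalForm_cons`,
`isReduced_iff_forall_length_le`). Hence a `𝔹`-path whose image is homotopic to a path of length
zero is itself homotopic to one. Applied to closed paths this makes `ν` injective; applied to `p⁻¹q`
it makes `φ` injective.

Normal forms also show that the first edge of a reduced path and the coset of its first element are
homotopy invariants (`Homotopic.star_eq_of_cons`). So a tree vertex has at most one neighbour closer
to the base, and the Bass–Serre tree is acyclic.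

For the splitting, `𝔹` is recovered from the action of its own fundamental group on its own tree:
paths `P z` along a spanning tree give lifts of vertices, and `loop P` turns arbitrary paths into
group elements. The injections `ν` and `φ` carry this to `U` and `Y`. -/

namespace GraphOfGroups

variable {V : Type u} [SerreGraph.{u, v} V] {𝔸 : GraphOfGroups.{u, v, w₁, w₂} V}

/-! ### Normal forms of paths. -/

open Classical in
/-- A representative of the coset `a α_e(A_e)`; it is `1` for the trivial coset. -/
noncomputable def cosetRep {x y : V} (e : x ⟶ y) (a : 𝔸.vertexGroup x) : 𝔸.vertexGroup x :=
  if a ∈ (𝔸.α e).range then 1 else (a : 𝔸.vertexGroup x ⧸ (𝔸.α e).range).out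

theorem exists_eq_cosetRep_mul {x y : V} (e : x ⟶ y) (a : 𝔸.vertexGroup x) :
    ∃ c, a = cosetRep e a * 𝔸.α e c := by
  unfold cosetRep
  split_ifs with h
  · obtain ⟨c, rfl⟩ := h
    exact ⟨c, (one_mul _).symm⟩
  · obtain ⟨⟨_, c, rfl⟩, h⟩ := QuotientGroup.mk_out_eq_mul (𝔸.α e).range a
    exact ⟨c⁻¹, by rw [h]; simp⟩

theorem cosetRep_mul {x y : V} (e : x ⟶ y) (a : 𝔸.vertexGroup x) (c : 𝔸.edgeGroup e) :
    cosetRep e (a * 𝔸.α e c) = cosetRep e a := by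
  have h : 𝔸.α e c ∈ (𝔸.α e).range := ⟨c, rfl⟩
  unfold cosetRep
  rw [Subgroup.mul_mem_cancel_right _ h, QuotientGroup.mk_mul_of_mem a h]

theorem cosetRep_α {x y : V} (e : x ⟶ y) (c : 𝔸.edgeGroup e) : cosetRep e (𝔸.α e c) = 1 :=
  if_pos ⟨c, rfl⟩

theorem cosetRep_one {x y : V} (e : x ⟶ y) : cosetRep e (1 : 𝔸.vertexGroup x) = 1 :=
  if_pos (one_mem _)

/-- The element `c` with `a = cosetRep e a * α_e(c)`. -/
noncomputable def cosetArg {x y : V} (e : x ⟶ y) (a : 𝔸.vertexGroup x) : 𝔸.edgeGroup e :=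
  (exists_eq_cosetRep_mul e a).choose

theorem cosetRep_mul_cosetArg {x y : V} (e : x ⟶ y) (a : 𝔸.vertexGroup x) :
    cosetRep e a * 𝔸.α e (cosetArg e a) = a :=
  (exists_eq_cosetRep_mul e a).choose_spec.symm

theorem cosetArg_eq {x y : V} (e : x ⟶ y) {a : 𝔸.vertexGroup x} {c : 𝔸.edgeGroup e}
    (h : a = cosetRep e a * 𝔸.α e c) : cosetArg e a = c :=
  𝔸.α_injective e (mul_left_cancel ((cosetRep_mul_cosetArg e a).trans h))

theorem cosetRep_cosetRep {x y : V} (e : x ⟶ y) (a : 𝔸.vertexGroup x) :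
    cosetRep e (cosetRep e a) = cosetRep e a := by
  rw [← cosetRep_mul e _ (cosetArg e a), cosetRep_mul_cosetArg]

theorem cosetRep_mul_cosetRep {x y : V} (e : x ⟶ y) (a b : 𝔸.vertexGroup x) :
    cosetRep e (a * cosetRep e b) = cosetRep e (a * b) := by
  rw [← cosetRep_mul e _ (cosetArg e b), mul_assoc, cosetRep_mul_cosetArg]

theorem exists_eq_mul_of_cosetRep_eq {x y : V} (e : x ⟶ y) {a b : 𝔸.vertexGroup x}
    (h : cosetRep e a = cosetRep e b) : ∃ c, b = a * 𝔸.α e c := by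
  refine ⟨(cosetArg e a)⁻¹ * cosetArg e b, ?_⟩
  rw [map_mul, map_inv]
  nth_rw 1 [← cosetRep_mul_cosetArg e b, ← cosetRep_mul_cosetArg e a]
  simp [h]

namespace Path

theorem star_eq_of_cons_eq {x y y' z : V} {a b : 𝔸.vertexGroup x} {e : x ⟶ y} {f : x ⟶ y'}
    {p : 𝔸.Path y z} {q : 𝔸.Path y' z} (h : cons a e p = cons b f q) :
    (⟨y, e⟩ : Quiver.Star x) = ⟨y', f⟩ ∧ a = b := by
  cases h
  exact ⟨rfl, rfl⟩

/-- Left multiplication of a normal form by a group element, put into normal form. -/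
noncomputable def normalLmul {x z : V} (a : 𝔸.vertexGroup x) : 𝔸.Path x z → 𝔸.Path x z
  | nil b => nil (a * b)
  | cons b e p =>
    -- The remainder `α_e(c)` left by the coset representative crosses `e` and becomes `ω_e(c)`.
    cons (cosetRep e (a * b)) e (normalLmul (𝔸.ω e (cosetArg e (a * b))) p)

open Classical in
/-- Left multiplication of a normal form by an edge, put into normal form. -/
noncomputable def normalEdge {x y z : V} (e : x ⟶ y) (p : 𝔸.Path y z) : 𝔸.Path x z :=
  -- Testing for the literal `1` detects every cancellation in a normal form: a representative lying
  -- in `ω_e(A_e) = α_{e⁻¹}(A_{e⁻¹})` represents the trivial coset.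
  if h : ∃ q, p = cons 1 (Quiver.reverse e) q then h.choose else cons 1 e p

/-- Normal forms: all group elements but the last are coset representatives, and there is no
backtracking. -/
def IsNormal {x z : V} : 𝔸.Path x z → Prop
  | nil _ => True
  | cons a e p => cosetRep e a = a ∧ (¬ ∃ q, p = cons 1 (Quiver.reverse e) q) ∧ IsNormal p

theorem normalEdge_cons {x y z : V} (e : x ⟶ y) (q : 𝔸.Path x z) :
    normalEdge e (cons 1 (Quiver.reverse e) q) = q := by
  have h : ∃ q', cons (1 : 𝔸.vertexGroup y) (Quiver.reverse e) q = cons 1 (Quiver.reverse e) q' :=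
    ⟨q, rfl⟩
  have h' : ∀ q', cons (1 : 𝔸.vertexGroup y) (Quiver.reverse e) q = cons 1 (Quiver.reverse e) q' →
      q' = q := by
    rintro _ ⟨⟩
    rfl
  rw [normalEdge, dif_pos h]
  exact h' _ h.choose_spec

theorem normalEdge_of_not {x y z : V} (e : x ⟶ y) {p : 𝔸.Path y z}
    (h : ¬ ∃ q, p = cons 1 (Quiver.reverse e) q) : normalEdge e p = cons 1 e p :=
  dif_neg h

theorem normalLmul_mul {x z : V} (a b : 𝔸.vertexGroup x) (p : 𝔸.Path x z) :
    normalLmul (a * b) p = normalLmul a (normalLmul b p) := by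
  induction p with
  | nil d => simp [normalLmul, mul_assoc]
  | cons d e p ih =>
    simp only [normalLmul]
    rw [cosetRep_mul_cosetRep, ← ih, ← map_mul, mul_assoc]
    congr 3
    -- Remainders compose: the one of `a * (b * d)` is the one of `a * cosetRep e (b * d)` times the
    -- one of `b * d`.
    apply cosetArg_eq
    rw [map_mul, ← mul_assoc (cosetRep e _), ← cosetRep_mul_cosetRep,
      cosetRep_mul_cosetArg, mul_assoc, cosetRep_mul_cosetArg]

theorem IsNormal.normalLmul_one {x z : V} {p : 𝔸.Path x z} (h : p.IsNormal) :
    normalLmul 1 p = p := by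
  induction p with
  | nil d => simp [normalLmul]
  | cons d e p ih =>
    obtain ⟨h₁, -, h₂⟩ := h
    have : cosetArg e d = 1 := cosetArg_eq e (by simp [h₁])
    simp only [normalLmul, one_mul, h₁, this, map_one, ih h₂]

/-- Since `ω_e(c) = α_{e⁻¹}(c)`, the leading representative stays `1` and the whole factor crosses
`e⁻¹`. -/
theorem normalLmul_ω_cons {x y z : V} (e : x ⟶ y) (c : 𝔸.edgeGroup e) (q : 𝔸.Path x z) :
    normalLmul (𝔸.ω e c) (cons 1 (Quiver.reverse e) q) =
      cons 1 (Quiver.reverse e) (normalLmul (𝔸.α e c) q) := by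
  simp only [normalLmul, mul_one]
  rw [← 𝔸.α_bar, cosetRep_α, cosetArg_eq (Quiver.reverse e) (c := 𝔸.bar e c), 𝔸.ω_bar]
  rw [cosetRep_α, one_mul]

/-- Multiplication by `ω_e(c)` preserves the shape `1, e⁻¹, ⋯` and is invertible on normal forms, so
it cannot create that shape either. -/
theorem IsNormal.normalLmul_ω_ne {x y z : V} (e : x ⟶ y) (c : 𝔸.edgeGroup e) {p : 𝔸.Path y z}
    (hp : p.IsNormal) (h : ¬ ∃ q, p = cons 1 (Quiver.reverse e) q) :
    ¬ ∃ q, normalLmul (𝔸.ω e c) p = cons 1 (Quiver.reverse e) q := by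
  rintro ⟨q, hq⟩
  refine h ⟨normalLmul (𝔸.α e c⁻¹) q, ?_⟩
  rw [← normalLmul_ω_cons, ← hq, ← normalLmul_mul, ← map_mul, inv_mul_cancel, map_one,
    hp.normalLmul_one]

theorem IsNormal.normalLmul {x z : V} (a : 𝔸.vertexGroup x) {p : 𝔸.Path x z} (h : p.IsNormal) :
    (normalLmul a p).IsNormal := by
  induction p with
  | nil d => trivial
  | cons d e p ih => exact ⟨cosetRep_cosetRep _ _, h.2.2.normalLmul_ω_ne e _ h.2.1, ih _ h.2.2⟩

theorem IsNormal.normalEdge {x y z : V} (e : x ⟶ y) {p : 𝔸.Path y z} (h : p.IsNormal) :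
    (normalEdge e p).IsNormal := by
  by_cases hp : ∃ q, p = cons 1 (Quiver.reverse e) q
  · obtain ⟨q, rfl⟩ := hp
    rw [normalEdge_cons]
    exact h.2.2
  · rw [normalEdge_of_not e hp]
    exact ⟨cosetRep_one e, hp, h⟩

theorem IsNormal.normalEdge_normalLmul_ω {x y z : V} (e : x ⟶ y) (c : 𝔸.edgeGroup e)
    {p : 𝔸.Path y z} (h : p.IsNormal) :
    Path.normalEdge e (Path.normalLmul (𝔸.ω e c) p) =
      Path.normalLmul (𝔸.α e c) (Path.normalEdge e p) := by
  by_cases hp : ∃ q, p = cons 1 (Quiver.reverse e) q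
  · obtain ⟨q, rfl⟩ := hp
    rw [normalLmul_ω_cons, normalEdge_cons, normalEdge_cons]
  · rw [normalEdge_of_not e hp, normalEdge_of_not e (h.normalLmul_ω_ne e c hp)]
    simp only [Path.normalLmul, mul_one, cosetRep_α]
    rw [cosetArg_eq e (c := c)]
    rw [cosetRep_α, one_mul]

theorem IsNormal.normalEdge_normalEdge {x y z : V} (e : x ⟶ y) {p : 𝔸.Path x z}
    (h : p.IsNormal) :
    Path.normalEdge e (Path.normalEdge (Quiver.reverse e) p) = p := by
  by_cases hp : ∃ q, p = cons 1 (Quiver.reverse (Quiver.reverse e)) q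
  · obtain ⟨q, rfl⟩ := hp
    rw [normalEdge_cons]
    simp only [Quiver.reverse_reverse] at h ⊢
    -- Here `e⁻¹` has removed a leading `e`; normality of `p` ensures that what remains does not
    -- start with `1, e⁻¹`, so `e` is put back.
    exact normalEdge_of_not e h.2.1
  · rw [normalEdge_of_not _ hp, normalEdge_cons]

/-- The action of a path on normal forms. -/
noncomputable def normalAct {x y z : V} : 𝔸.Path x y → 𝔸.Path y z → 𝔸.Path x z
  | nil a, r => normalLmul a r
  | cons a e p, r => normalLmul a (normalEdge e (normalAct p r))

theorem normalAct_append {x y y' z : V} (p : 𝔸.Path x y) (q : 𝔸.Path y y') (r : 𝔸.Path y' z) :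
    normalAct (p.append q) r = normalAct p (normalAct q r) := by
  induction p with
  | nil a => cases q <;> simp [nil_append, lmul_nil, lmul_cons, normalAct, normalLmul_mul]
  | cons a e p ih => simp [cons_append, normalAct, ih]

theorem IsNormal.normalAct {x y z : V} (p : 𝔸.Path x y) {r : 𝔸.Path y z} (h : r.IsNormal) :
    (normalAct p r).IsNormal := by
  induction p with
  | nil a => exact h.normalLmul a
  | cons a e p ih => exact ((ih h).normalEdge e).normalLmul a

/-- The generating relation holds because `ω_e(c)` crosses `e` as `α_e(c)` and then `e, e⁻¹` cancel.
Both need a normal argument, which is why `r` is normal. -/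
theorem Homotopic.normalAct_eq {x y z : V} {p q : 𝔸.Path x y} (h : Homotopic p q)
    {r : 𝔸.Path y z} (hr : r.IsNormal) : normalAct p r = normalAct q r := by
  induction h with
  | refl p => rfl
  | symm _ ih => exact (ih hr).symm
  | trans _ _ ih₁ ih₂ => exact (ih₁ hr).trans (ih₂ hr)
  | append _ _ ih₁ ih₂ => rw [normalAct_append, normalAct_append, ih₂ hr, ih₁ (hr.normalAct _)]
  | backtrack a e c a' =>
    simp only [Path.backtrack, normalAct, normalLmul_mul]
    have h := (hr.normalLmul a').normalEdge (Quiver.reverse e)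
    rw [h.normalEdge_normalLmul_ω, (hr.normalLmul a').normalEdge_normalEdge]

/-- The normal form of a path. -/
noncomputable def normalForm {x y : V} (p : 𝔸.Path x y) : 𝔸.Path x y := normalAct p (nil 1)

theorem Homotopic.normalForm_eq {x y : V} {p q : 𝔸.Path x y} (h : Homotopic p q) :
    p.normalForm = q.normalForm :=
  h.normalAct_eq trivial

theorem normalForm_nil {x : V} (a : 𝔸.vertexGroup x) : (nil a).normalForm = nil a := by
  simp [normalForm, normalAct, normalLmul]

theorem length_normalLmul {x y : V} (a : 𝔸.vertexGroup x) (p : 𝔸.Path x y) :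
    (normalLmul a p).length = p.length := by
  induction p with
  | nil => rfl
  | cons b e p ih => simp [normalLmul, length, ih]

theorem length_normalEdge_le {x y z : V} (e : x ⟶ y) (p : 𝔸.Path y z) :
    (normalEdge e p).length ≤ p.length + 1 := by
  by_cases hp : ∃ q, p = cons 1 (Quiver.reverse e) q
  · obtain ⟨q, rfl⟩ := hp
    rw [normalEdge_cons]
    simp only [length]
    omega
  · rw [normalEdge_of_not e hp]
    rfl

theorem length_normalForm_le {x y : V} (p : 𝔸.Path x y) : p.normalForm.length ≤ p.length := by
  unfold normalForm
  induction p with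
  | nil a => exact le_rfl
  | cons a e p ih =>
    rw [normalAct, length_normalLmul, length]
    exact (length_normalEdge_le e _).trans (by omega)

/-- Paths of length zero are their own normal forms; thus vertex groups embed in the fundamental
group. -/
theorem Homotopic.eq_of_nil {x : V} {a b : 𝔸.vertexGroup x} (h : Homotopic (nil a) (nil b)) :
    a = b := by
  have h := h.normalForm_eq
  rw [normalForm_nil, normalForm_nil] at h
  injection h

theorem isReduced_nil {x : V} (a : 𝔸.vertexGroup x) : (nil a).IsReduced := by
  rintro ⟨s, t, q, b, e, c, a', r, h⟩
  have := congrArg length h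
  simp only [length_append, backtrack, length] at this
  omega

theorem IsReduced.of_cons {x y z : V} {a : 𝔸.vertexGroup x} {e : x ⟶ y} {p : 𝔸.Path y z}
    (h : (cons a e p).IsReduced) : p.IsReduced := by
  rintro ⟨s, t, q, b, f, c, a', r, rfl⟩
  exact h ⟨s, t, cons a e q, b, f, c, a', r, rfl⟩

theorem IsReduced.not_backtrack {x y z : V} {a : 𝔸.vertexGroup x} {e : x ⟶ y} {p : 𝔸.Path y z}
    (h : (cons a e p).IsReduced) :
    ¬ ∃ c q, p = cons (𝔸.ω e c) (Quiver.reverse e) q := by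
  rintro ⟨c, q, rfl⟩
  refine h ⟨_, _, nil 1, a, e, c, 1, q, ?_⟩
  simp [backtrack, nil_append, cons_append, lmul_one]

theorem IsReduced.cons {x y z : V} {a : 𝔸.vertexGroup x} {e : x ⟶ y} {p : 𝔸.Path y z}
    (hp : p.IsReduced) (h : ¬ ∃ c q, p = cons (𝔸.ω e c) (Quiver.reverse e) q) :
    (cons a e p).IsReduced := by
  rintro ⟨s, t, q, b, f, c, a', r, hq⟩
  cases q with
  | nil d =>
    simp only [backtrack, nil_append, cons_append, lmul_cons] at hq
    cases hq
    exact h ⟨c, _, rfl⟩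
  | cons d f' q =>
    simp only [cons_append] at hq
    cases hq
    exact hp ⟨_, _, q, b, f, c, a', r, rfl⟩

theorem IsReduced.lmul {x y : V} (a : 𝔸.vertexGroup x) {p : 𝔸.Path x y} (h : p.IsReduced) :
    (lmul a p).IsReduced := by
  cases p with
  | nil b => exact isReduced_nil _
  | cons b e p => exact h.of_cons.cons h.not_backtrack

/-- Prepending `e` to the normal form of `p` never cancels: a leading `1, e⁻¹` there would come from
a first element of `p` in `α_{e⁻¹}(A_{e⁻¹}) = ω_e(A_e)`, followed by `e⁻¹`, which is a backtrack in
the given path. -/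
theorem IsReduced.normalForm_cons {x y z : V} {a : 𝔸.vertexGroup x} {e : x ⟶ y}
    {p : 𝔸.Path y z} (h : (Path.cons a e p).IsReduced) :
    (Path.cons a e p).normalForm = Path.cons (cosetRep e a) e
      (normalLmul (𝔸.ω e (cosetArg e a)) p.normalForm) := by
  induction p generalizing x a with
  | nil b =>
    rw [normalForm_nil]
    simp only [normalForm, normalAct]
    rw [normalEdge_of_not]
    · simp [normalLmul]
    · rintro ⟨q, hq⟩
      simpa [normalLmul, length] using congrArg length hq
  | cons b f p ih =>
    have hp := ih h.of_cons
    rw [normalForm, normalAct, ← normalForm, normalEdge_of_not]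
    · simp [normalLmul]
    · rw [hp]
      rintro ⟨q, hq⟩
      obtain ⟨hf, hb⟩ := star_eq_of_cons_eq hq
      cases hf
      obtain ⟨c, rfl⟩ : ∃ c, b = 𝔸.α (Quiver.reverse e) c :=
        ⟨_, by simpa [hb] using (cosetRep_mul_cosetArg (Quiver.reverse e) b).symm⟩
      refine h.not_backtrack ⟨(𝔸.bar e).symm c, p, ?_⟩
      rw [← 𝔸.α_bar, MulEquiv.apply_symm_apply]

end Path
end GraphOfGroups

/-! ### A criterion for acyclicity. -/

/-- A graph is acyclic if it has a height function that separates adjacent vertices, and every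
vertex has at most one lower neighbour. -/
theorem SimpleGraph.isAcyclic_of_height {W : Type*} {G : SimpleGraph W} (d : W → ℕ)
    (hne : ∀ s t, G.Adj s t → d s ≠ d t)
    (huniq : ∀ s t t', G.Adj t s → G.Adj t' s → d t < d s → d t' < d s → t = t') :
    G.IsAcyclic := by
  classical
  intro w c hc
  -- At a highest vertex of a cycle both cycle neighbours are lower, so they coincide, which is
  -- impossible in a cycle.
  obtain ⟨m, hm, hmax⟩ := c.support.toFinset.exists_max_image d
    ⟨w, List.mem_toFinset.2 c.start_mem_support⟩
  rw [List.mem_toFinset] at hm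
  have hc' := hc.rotate hm
  have hle : ∀ t ∈ (c.rotate m hm).support, d t ≤ d m := fun t ht =>
    hmax t (List.mem_toFinset.2 ((c.mem_support_rotate_iff m hm).1 ht))
  have h₁ := (c.rotate m hm).adj_snd hc'.not_nil
  have h₂ := (c.rotate m hm).adj_penultimate hc'.not_nil
  refine hc'.snd_ne_penultimate (huniq m _ _ h₁.symm h₂ ?_ ?_)
  · exact lt_of_le_of_ne (hle _ (SimpleGraph.Walk.getVert_mem_support _ _)) (hne _ _ h₁.symm)
  · exact lt_of_le_of_ne (hle _ (SimpleGraph.Walk.getVert_mem_support _ _)) (hne _ _ h₂)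

/-! ### Reduced paths as shortest representatives. -/

namespace GraphOfGroups

variable {V : Type u} [SerreGraph.{u, v} V] {𝔸 : GraphOfGroups.{u, v, w₁, w₂} V}

namespace Path

theorem IsReduced.length_normalForm {x y : V} {p : 𝔸.Path x y} (h : p.IsReduced) :
    p.normalForm.length = p.length := by
  induction p with
  | nil a => rw [normalForm_nil]
  | cons a e p ih => rw [h.normalForm_cons, length, length_normalLmul, ih h.of_cons, length]

theorem exists_homotopic_length_lt {x y : V} {p : 𝔸.Path x y} (h : ¬ p.IsReduced) :
    ∃ q, Homotopic p q ∧ q.length < p.length := by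
  unfold IsReduced at h
  rw [not_not] at h
  obtain ⟨s, t, q, a, e, c, a', r, rfl⟩ := h
  refine ⟨_, (Homotopic.refl q).append ((Homotopic.backtrack a e c a').append (.refl r)), ?_⟩
  simp only [length_append, backtrack, length]
  omega

/-- Normalizing never lengthens a path and preserves the length of a reduced one, while an
elementary reduction shortens by two. -/
theorem isReduced_iff_forall_length_le {x y : V} {p : 𝔸.Path x y} :
    p.IsReduced ↔ ∀ q, Homotopic p q → p.length ≤ q.length := by
  refine ⟨fun h q hq => ?_, fun h => ?_⟩
  · rw [← h.length_normalForm, hq.normalForm_eq]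
    exact length_normalForm_le q
  · by_contra hp
    obtain ⟨q, hq, hlt⟩ := exists_homotopic_length_lt hp
    exact absurd (h q hq) (by omega)

theorem exists_isReduced_homotopic {x y : V} (p : 𝔸.Path x y) :
    ∃ q, q.IsReduced ∧ Homotopic p q := by
  induction hn : p.length using Nat.strong_induction_on generalizing p with
  | _ n ih =>
    by_cases hp : p.IsReduced
    · exact ⟨p, hp, .refl p⟩
    · obtain ⟨q, hq, hlt⟩ := exists_homotopic_length_lt hp
      obtain ⟨r, hr, hqr⟩ := ih _ (hn ▸ hlt) q rfl
      exact ⟨r, hr, hq.trans hqr⟩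

theorem inv_lmul {x y : V} (a : 𝔸.vertexGroup x) (p : 𝔸.Path x y) :
    (lmul a p).inv = p.inv.append (nil a⁻¹) := by
  cases p <;> simp [lmul_nil, lmul_cons, inv, nil_append, append_assoc, cons_append]

theorem append_inv_rev {x y z : V} (p : 𝔸.Path x y) (q : 𝔸.Path y z) :
    (p.append q).inv = q.inv.append p.inv := by
  induction p with
  | nil a => exact inv_lmul a q
  | cons a e p ih => simp [cons_append, inv, ih, append_assoc]

theorem inv_inv_eq {x y : V} (p : 𝔸.Path x y) : p.inv.inv = p := by
  induction p with
  | nil a => simp [inv]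
  | cons a e p ih =>
    simp [inv, append_inv_rev, ih, nil_append, cons_append, lmul_cons, lmul_one]

theorem length_inv {x y : V} (p : 𝔸.Path x y) : p.inv.length = p.length := by
  induction p with
  | nil a => rfl
  | cons a e p ih => simp [inv, length_append, length, ih]

/-- By the length criterion: inversion preserves length and homotopy. -/
theorem IsReduced.inv {x y : V} {p : 𝔸.Path x y} (h : p.IsReduced) : p.inv.IsReduced := by
  rw [isReduced_iff_forall_length_le] at h ⊢
  intro q hq
  rw [length_inv, ← length_inv q]
  exact h _ (by simpa [inv_inv_eq] using hq.inv)

theorem IsReduced.append_nil {x y : V} {p : 𝔸.Path x y} (h : p.IsReduced)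
    (a : 𝔸.vertexGroup y) : (p.append (nil a)).IsReduced := by
  have h := (h.inv.lmul a⁻¹).inv
  rwa [inv_lmul, inv_inv_eq, inv_inv] at h

theorem Homotopic.append_left_cancel {x y z : V} {p : 𝔸.Path x y} {q r : 𝔸.Path y z}
    (h : Homotopic (p.append q) (p.append r)) : Homotopic q r := by
  have key : ∀ s : 𝔸.Path y z, Homotopic (p.inv.append (p.append s)) s := fun s => by
    rw [← append_assoc]
    simpa [nil_append, lmul_one] using (inv_append p).append (Homotopic.refl s)
  exact (key q).symm.trans (((Homotopic.refl p.inv).append h).trans (key r))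

theorem Homotopic.cons_cancel {x y z : V} {a : 𝔸.vertexGroup x} {e : x ⟶ y} {p q : 𝔸.Path y z}
    (h : Homotopic (Path.cons a e p) (Path.cons a e q)) : Homotopic p q := by
  refine append_left_cancel (p := Path.cons a e (nil 1)) ?_
  simpa [cons_append, nil_append, lmul_one] using h

/-- The path `a, e, b, ⋯` is homotopic to `a α_e(c), e, ω_e(c)⁻¹ b, ⋯`. -/
theorem homotopic_cons_mul_α {x y z : V} (a : 𝔸.vertexGroup x) (e : x ⟶ y) (c : 𝔸.edgeGroup e)
    (p : 𝔸.Path y z) : Homotopic (cons (a * 𝔸.α e c) e p) (cons a e (lmul (𝔸.ω e c) p)) := by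
  -- Both sides are reductions of `a, e, ω_e(c), e⁻¹, 1, e, p`: one cancels the first two edges, the
  -- other the two displayed last.
  have h₁ := (Homotopic.backtrack a e c 1).append (Homotopic.refl (cons 1 e p))
  have h₂ := (Homotopic.backtrack 1 (Quiver.reverse e) 1 1).append (Homotopic.refl p)
  have h₃ := (h₂.lmul (𝔸.ω e c)).cons a e
  simp only [Path.backtrack, nil_append, cons_append, lmul_cons, mul_one, map_one,
    Quiver.reverse_reverse, lmul_one] at h₁ h₃
  exact h₁.symm.trans h₃

/-- Uniqueness of the first edge of a reduced path in a homotopy class. -/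
theorem Homotopic.star_eq_of_cons {x y y' z : V} {a b : 𝔸.vertexGroup x} {e : x ⟶ y}
    {f : x ⟶ y'} {p : 𝔸.Path y z} {q : 𝔸.Path y' z}
    (h : Homotopic (Path.cons a e p) (Path.cons b f q)) (hp : (Path.cons a e p).IsReduced)
    (hq : (Path.cons b f q).IsReduced) :
    (⟨y, e⟩ : Quiver.Star x) = ⟨y', f⟩ ∧ ∃ c, b = a * 𝔸.α e c := by
  have h := h.normalForm_eq
  rw [hp.normalForm_cons, hq.normalForm_cons] at h
  obtain ⟨h, h'⟩ := star_eq_of_cons_eq h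
  cases h
  exact ⟨rfl, exists_eq_mul_of_cosetRep_eq e h'⟩

/-- A shorter homotopic path would have a length of the other parity. -/
theorem isReduced_of_length_le_one {x y : V} {p : 𝔸.Path x y} (h : p.length ≤ 1) :
    p.IsReduced := by
  rw [isReduced_iff_forall_length_le]
  intro q hq
  have := hq.length_mod
  omega

end Path

/-! ### The Bass–Serre tree is a tree. -/

namespace TreeVertex

variable {v₀ : V}

theorem mk_eq_mk_iff_homotopic {y : V} {p q : 𝔸.Path v₀ y} :
    mk p = mk q ↔ ∃ a, Homotopic p (q.append (nil a)) := by
  refine ⟨fun h => ?_, fun ⟨a, h⟩ => (mk_eq_of_homotopic h).trans (mk_append_nil q a)⟩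
  exact Quotient.exact (s := cosetSetoid 𝔸 v₀ y) (eq_of_heq (Sigma.mk.inj h).2)

/-- The path `r` of length zero encodes both `y = y'` and the vertex-group element, avoiding
transport along an equality of vertices. -/
theorem mk_eq_mk_iff {y y' : V} {p : 𝔸.Path v₀ y} {q : 𝔸.Path v₀ y'} :
    mk p = mk q ↔ ∃ r : 𝔸.Path y y', r.length = 0 ∧ Homotopic q (p.append r) := by
  constructor
  · intro h
    obtain rfl : y = y' := congrArg Sigma.fst h
    obtain ⟨a, h⟩ := mk_eq_mk_iff_homotopic.1 h.symm
    exact ⟨nil a, rfl, h⟩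
  · rintro ⟨r, hr, h⟩
    cases r with
    | nil a => exact (mk_eq_mk_iff_homotopic.2 ⟨a, h⟩).symm
    | cons a e r => simp [length] at hr

theorem exists_rep (s : TreeVertex 𝔸 v₀) : ∃ (y : V) (p : 𝔸.Path v₀ y), s = mk p := by
  obtain ⟨y, ⟨p⟩⟩ := s
  exact ⟨y, p, rfl⟩

/-- The distance to the base vertex: the minimal length of a path that represents the vertex. -/
noncomputable def depth (s : TreeVertex 𝔸 v₀) : ℕ :=
  sInf {n | ∃ (y : V) (p : 𝔸.Path v₀ y), s = mk p ∧ p.length = n}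

theorem depth_mk_le {y : V} (p : 𝔸.Path v₀ y) : depth (mk p) ≤ p.length :=
  Nat.sInf_le ⟨y, p, rfl, rfl⟩

theorem exists_rep_length_eq_depth (s : TreeVertex 𝔸 v₀) :
    ∃ (y : V) (p : 𝔸.Path v₀ y), s = mk p ∧ p.length = depth s := by
  obtain ⟨y, p, rfl⟩ := exists_rep s
  exact Nat.sInf_mem (s := {n | ∃ (y' : V) (q : 𝔸.Path v₀ y'), mk p = mk q ∧ q.length = n})
    ⟨_, y, p, rfl, rfl⟩

theorem isReduced_of_length_le_depth {y : V} {p : 𝔸.Path v₀ y} (h : p.length ≤ depth (mk p)) :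
    p.IsReduced := by
  rw [isReduced_iff_forall_length_le]
  intro q hq
  rw [mk_eq_of_homotopic hq] at h
  exact h.trans (depth_mk_le q)

theorem parity_eq_depth_mod (s : TreeVertex 𝔸 v₀) : parity s = depth s % 2 := by
  obtain ⟨y, p, hs, hp⟩ := exists_rep_length_eq_depth s
  rw [← hp, hs]
  rfl

theorem Adj.depth_ne {s t : TreeVertex 𝔸 v₀} (h : Adj s t) : depth s ≠ depth t := by
  intro hd
  have hd : parity s = parity t := by rw [parity_eq_depth_mod, parity_eq_depth_mod, hd]
  obtain ⟨x, y, p, a, e, rfl, rfl⟩ := h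
  simp only [parity, mk, Quotient.lift_mk, length_append, length] at hd
  omega

/-- Any representative `p` can serve: its discrepancy from the one given by `Adj` is absorbed into
the element before the edge. -/
theorem Adj.exists_eq_mk {x : V} {p : 𝔸.Path v₀ x} {t : TreeVertex 𝔸 v₀} (h : Adj (mk p) t) :
    ∃ (y : V) (a : 𝔸.vertexGroup x) (e : x ⟶ y), t = mk (p.append (cons a e (nil 1))) := by
  obtain ⟨x', y, q, a, e, hs, rfl⟩ := h
  obtain ⟨r, hr, h⟩ := mk_eq_mk_iff.1 hs
  cases r with
  | nil b =>
    refine ⟨y, b * a, e, mk_eq_of_homotopic ?_⟩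
    have := h.append (Homotopic.refl (cons a e (nil 1)))
    rwa [append_assoc] at this
  | cons b e r => simp [length] at hr

theorem adj_mk_append {x y : V} (p : 𝔸.Path v₀ x) (a : 𝔸.vertexGroup x) (e : x ⟶ y) (b) :
    Adj (mk p) (mk (p.append (cons a e (nil b)))) := by
  refine ⟨x, y, p, a, e, rfl, ?_⟩
  rw [← mk_append_nil (p.append (cons a e (nil 1))) b, append_assoc]
  simp [cons_append, nil_append, lmul_nil]

theorem Adj.smul (g : FundamentalGroup 𝔸 v₀) {s t : TreeVertex 𝔸 v₀} (h : Adj s t) :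
    Adj (g • s) (g • t) := by
  obtain ⟨q⟩ := g
  obtain ⟨x, y, p, a, e, rfl, rfl⟩ := h
  exact ⟨x, y, q.append p, a, e, rfl, congrArg mk (append_assoc q p _).symm⟩

/-- A vertex has at most one neighbour that is closer to the base vertex. -/
theorem Adj.eq_of_depth_lt {s t t' : TreeVertex 𝔸 v₀} (h : Adj t s) (h' : Adj t' s)
    (hd : depth t < depth s) (hd' : depth t' < depth s) : t = t' := by
  obtain ⟨x, p, rfl, hp⟩ := exists_rep_length_eq_depth t
  obtain ⟨x', p', rfl, hp'⟩ := exists_rep_length_eq_depth t'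
  obtain ⟨y, a, e, rfl⟩ := h.exists_eq_mk
  obtain ⟨y', a', e', hs⟩ := h'.exists_eq_mk
  -- These paths to `s` are no longer than the depth of `s`, hence reduced.
  have hr : (p.append (cons a e (nil 1))).IsReduced :=
    isReduced_of_length_le_depth (by simp only [length_append, length]; omega)
  have hr' : (p'.append (cons a' e' (nil 1))).IsReduced :=
    isReduced_of_length_le_depth (by rw [← hs]; simp only [length_append, length]; omega)
  obtain ⟨r, hr₀, hpr⟩ := mk_eq_mk_iff.1 hs
  cases r with
  | cons b e r => simp [length] at hr₀
  | nil b =>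
    rw [append_assoc] at hpr
    -- Inversion turns the last edges into first edges, whose uniqueness is known; cancelling them
    -- leaves `p` and `p'` equal up to a final vertex-group element.
    have hi := hpr.inv
    have hr := (hr.append_nil b).inv
    have hr' := hr'.inv
    rw [append_assoc] at hr
    simp only [append_inv_rev, inv, nil_append, lmul_nil, cons_append, lmul_cons] at hi hr hr'
    obtain ⟨he, c, hc⟩ := hi.star_eq_of_cons hr' hr
    obtain ⟨rfl, he⟩ := Sigma.mk.inj he
    obtain rfl : e' = e := (Quiver.reverse_inj _ _).1 (eq_of_heq he)
    rw [hc] at hi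
    have hi := mk_eq_of_homotopic (hi.trans (homotopic_cons_mul_α _ _ c _)).cons_cancel.inv
    simpa only [inv_lmul, inv_inv_eq, mk_append_nil] using hi.symm

theorem reachable_mk_append {x y : V} (q : 𝔸.Path v₀ x) (p : 𝔸.Path x y) :
    (tree 𝔸 v₀).Reachable (mk q) (mk (q.append p)) := by
  induction p with
  | nil a => rw [mk_append_nil]
  | cons a e p ih =>
    have h : q.append (cons a e p) = (q.append (cons a e (nil 1))).append p := by
      rw [append_assoc, cons_append, nil_append, lmul_one]
    rw [h]
    exact (SimpleGraph.Adj.reachable (adj_mk_append q a e 1)).trans (ih _)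

end TreeVertex

theorem tree_connected (𝔸 : GraphOfGroups.{u, v, w₁, w₂} V) (v₀ : V) :
    (tree 𝔸 v₀).Connected := by
  have h : ∀ s, (tree 𝔸 v₀).Reachable (TreeVertex.base 𝔸 v₀) s := by
    intro s
    obtain ⟨y, p, rfl⟩ := TreeVertex.exists_rep s
    have := TreeVertex.reachable_mk_append (nil 1) p
    rwa [nil_append, lmul_one] at this
  exact { preconnected := fun s t => (h s).symm.trans (h t), nonempty := ⟨TreeVertex.base 𝔸 v₀⟩ }

theorem tree_isAcyclic (𝔸 : GraphOfGroups.{u, v, w₁, w₂} V) (v₀ : V) :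
    (tree 𝔸 v₀).IsAcyclic :=
  SimpleGraph.isAcyclic_of_height TreeVertex.depth (fun _ _ h => TreeVertex.Adj.depth_ne h)
    fun _ _ _ h h' => TreeVertex.Adj.eq_of_depth_lt h h'

theorem tree_isTree (𝔸 : GraphOfGroups.{u, v, w₁, w₂} V) (v₀ : V) : (tree 𝔸 v₀).IsTree :=
  ⟨tree_connected 𝔸 v₀, tree_isAcyclic 𝔸 v₀⟩

end GraphOfGroups

/-! ### Folded graphs: injectivity of `ν` and `φ`. -/

namespace AGraph

variable {V : Type u} [SerreGraph.{u, v} V] {𝔸 : GraphOfGroups.{u, v, w₁, w₂} V}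
  {B : Type u'} [SerreGraph.{u', v'} B] {𝓑 : AGraph 𝔸 B}

theorem length_μ {x y : B} (p : 𝓑.graphOfGroups.Path x y) : (𝓑.μ p).length = p.length := by
  induction p with
  | nil b => rfl
  | cons b f p ih => rw [μ_cons, length, length_lmul, ih, length]

theorem α_barType {x y : B} (f : x ⟶ y) (c : 𝔸.edgeGroup (𝓑.type.map f)) :
    𝔸.α (𝓑.type.map (Quiver.reverse f)) (𝓑.barType f c) = 𝔸.ω (𝓑.type.map f) c :=
  (α_edgeCongr _ _).trans (𝔸.α_bar _ c)

theorem IsFolded.isReduced_μ (h : 𝓑.IsFolded) {x y : B} {p : 𝓑.graphOfGroups.Path x y}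
    (hp : p.IsReduced) : (𝓑.μ p).IsReduced := by
  induction p with
  | nil b => exact isReduced_nil _
  | @cons x y z b f p ih =>
    rw [μ_cons]
    refine ((ih hp.of_cons).lmul _).cons ?_
    rintro ⟨c, q, hq⟩
    cases p with
    | nil b' => simpa [μ_nil, lmul_nil, length] using congrArg length hq
    | @cons _ w _ b' f' p =>
      rw [μ_cons, lmul_cons] at hq
      obtain ⟨hs, hb⟩ := star_eq_of_cons_eq hq
      have hb' : 𝓑.fα f' = (𝓑.incl y b')⁻¹ * (𝓑.fω f)⁻¹ * 𝔸.ω (𝓑.type.map f) c := by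
        rw [← hb]
        group
      -- First folding condition: `f'` and `f⁻¹` have the same type, and their labels differ by an
      -- element of `B_y` and an edge-group element.
      have hf : (⟨w, f'⟩ : Quiver.Star y) = ⟨x, Quiver.reverse f⟩ := by
        by_contra hne
        refine h (Or.inl ⟨y, ⟨x, Quiver.reverse f⟩, ⟨w, f'⟩, Ne.symm hne, ?_, (𝓑.incl y b')⁻¹,
          inv_mem b'.2, 𝓑.barType f c, ?_⟩)
        · rw [Prefunctor.star_apply, Prefunctor.star_apply, 𝓑.type_reverse]
          exact hs.symm
        · rw [α_barType, 𝓑.fα_reverse, hb']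
      cases hf
      have hω : 𝓑.conjω f c = 𝓑.incl y b' := by
        rw [𝓑.fα_reverse] at hb
        simp [conjω, ← hb, mul_assoc]
      have hc : c ∈ 𝓑.preω f := by
        rw [preω, Subgroup.mem_comap, hω]
        exact b'.2
      -- Second folding condition: it supplies the missing half of `c ∈ B_f`.
      have heq : 𝓑.preα f = 𝓑.preω f := by
        by_contra hne
        exact h (Or.inr ⟨x, y, f, hne⟩)
      refine hp.not_backtrack ⟨⟨c, heq ▸ hc, hc⟩, p, ?_⟩
      congr 1
      exact Subtype.ext hω.symm

theorem incl_injective (z : B) : Function.Injective (𝓑.incl z) := Subtype.val_injective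

/-- Every class of `𝔹`-paths contains a reduced one, so restricting to reduced paths loses nothing.
-/
theorem image_language (u₀ : B) :
    FundamentalGroup.mk '' 𝓑.language u₀ = ((𝓑.ν u₀).range : Set (FundamentalGroup 𝔸 _)) := by
  ext g
  constructor
  · rintro ⟨_, ⟨p, -, rfl⟩, rfl⟩
    exact ⟨FundamentalGroup.mk p, rfl⟩
  · rintro ⟨⟨p⟩, rfl⟩
    obtain ⟨q, hq, hpq⟩ := exists_isReduced_homotopic p
    exact ⟨_, ⟨q, hq, rfl⟩, (Quotient.sound (𝓑.μ_homotopic hpq)).symm⟩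

/-- A path whose image under `μ` is homotopic to a path of length `0` is homotopic to one. -/
theorem IsFolded.exists_homotopic_length_zero (h : 𝓑.IsFolded) {x y : B}
    {p : 𝓑.graphOfGroups.Path x y} {r : 𝔸.Path (𝓑.type.obj x) (𝓑.type.obj y)}
    (hr : r.length = 0) (hp : Homotopic (𝓑.μ p) r) :
    ∃ q : 𝓑.graphOfGroups.Path x y, q.length = 0 ∧ Homotopic p q := by
  obtain ⟨q, hq, hpq⟩ := exists_isReduced_homotopic p
  -- The image of the reduced path `q` is reduced, hence shortest in a class that contains `r`.
  have hle := isReduced_iff_forall_length_le.1 (h.isReduced_μ hq) r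
    ((𝓑.μ_homotopic hpq).symm.trans hp)
  rw [length_μ, hr] at hle
  exact ⟨q, Nat.le_zero.1 hle, hpq⟩

/-- A kernel element is represented by a single `b ∈ B_{u₀}`, and the vertex group of `𝔸` embeds in
its fundamental group. -/
theorem IsFolded.ν_injective (h : 𝓑.IsFolded) (u₀ : B) : Function.Injective (𝓑.ν u₀) := by
  rw [injective_iff_map_eq_one]
  rintro ⟨p⟩ hp
  have hp : Homotopic (𝓑.μ p) (nil 1) := Quotient.exact hp
  obtain ⟨q, hq, hpq⟩ := h.exists_homotopic_length_zero rfl hp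
  cases q with
  | nil b =>
    have hb : 𝓑.incl u₀ b = 1 := ((𝓑.μ_homotopic hpq).symm.trans hp).eq_of_nil
    obtain rfl : b = 1 := incl_injective u₀ (by rw [hb, map_one])
    exact Quotient.sound hpq
  | cons b f q => simp [length] at hq

theorem φ_mk (u₀ : B) {y : B} (p : 𝓑.graphOfGroups.Path u₀ y) :
    𝓑.φ u₀ (TreeVertex.mk p) = TreeVertex.mk (𝓑.μ p) := rfl

theorem φ_smul (u₀ : B) (g : FundamentalGroup 𝓑.graphOfGroups u₀)
    (s : TreeVertex 𝓑.graphOfGroups u₀) : 𝓑.φ u₀ (g • s) = 𝓑.ν u₀ g • 𝓑.φ u₀ s := by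
  obtain ⟨p⟩ := g
  obtain ⟨y, ⟨q⟩⟩ := s
  exact congrArg TreeVertex.mk (𝓑.μ_append p q)

/-- If `p` and `q` have the same image vertex, then `μ(p⁻¹q)` is homotopic to a path of length zero,
hence so is `p⁻¹q`. -/
theorem IsFolded.φ_injective (h : 𝓑.IsFolded) (u₀ : B) : Function.Injective (𝓑.φ u₀) := by
  intro s t hst
  obtain ⟨x, p, rfl⟩ := s.exists_rep
  obtain ⟨y, q, rfl⟩ := t.exists_rep
  rw [φ_mk, φ_mk, TreeVertex.mk_eq_mk_iff] at hst
  obtain ⟨r, hr, hqr⟩ := hst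
  have hq : Homotopic q (p.append (p.inv.append q)) := by
    rw [← append_assoc]
    simpa [nil_append, lmul_one] using ((append_inv p).append (.refl q)).symm
  have hμ := (𝓑.μ_homotopic hq).symm.trans hqr
  rw [μ_append] at hμ
  obtain ⟨r', hr', hp⟩ := h.exists_homotopic_length_zero hr hμ.append_left_cancel
  exact TreeVertex.mk_eq_mk_iff.2 ⟨r', hr', hq.trans ((Homotopic.refl p).append hp)⟩

end AGraph

/-! ### Paths as group elements, and stabilizers in the Bass–Serre tree. -/

namespace GraphOfGroups

variable {V : Type u} [SerreGraph.{u, v} V] {𝔸 : GraphOfGroups.{u, v, w₁, w₂} V} {v₀ : V}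

/-- The class of the closed path obtained from `p` by joining its ends to `v₀` along `P`. -/
def loop (P : ∀ z, 𝔸.Path v₀ z) {x y : V} (p : 𝔸.Path x y) : FundamentalGroup 𝔸 v₀ :=
  FundamentalGroup.mk ((P x).append (p.append (P y).inv))

section Loop

variable (P : ∀ z, 𝔸.Path v₀ z)

theorem FundamentalGroup.mk_eq {p q : 𝔸.Path v₀ v₀} (h : Homotopic p q) :
    FundamentalGroup.mk p = FundamentalGroup.mk q := Quotient.sound h

theorem loop_congr {x y : V} {p q : 𝔸.Path x y} (h : Homotopic p q) : loop P p = loop P q :=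
  FundamentalGroup.mk_eq ((Homotopic.refl _).append (h.append (.refl _)))

theorem homotopic_of_loop_eq {x y : V} {p q : 𝔸.Path x y} (h : loop P p = loop P q) :
    Homotopic p q := by
  have h : Homotopic _ _ := Quotient.exact h
  have h := h.append_left_cancel.inv
  rw [append_inv_rev, append_inv_rev] at h
  simpa [inv_inv_eq] using h.append_left_cancel.inv

theorem loop_append {x y z : V} (p : 𝔸.Path x y) (q : 𝔸.Path y z) :
    loop P (p.append q) = loop P p * loop P q := by
  refine FundamentalGroup.mk_eq (q := ((P x).append (p.append (P y).inv)).append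
    ((P y).append (q.append (P z).inv))) ?_
  simp only [append_assoc]
  refine (Homotopic.refl _).append ((Homotopic.refl _).append ?_)
  rw [← append_assoc]
  simpa [nil_append, lmul_one] using
    ((inv_append (P y)).append (Homotopic.refl (q.append (P z).inv))).symm

theorem loop_nil_one (x : V) : loop P (nil (1 : 𝔸.vertexGroup x)) = 1 := by
  refine FundamentalGroup.mk_eq ?_
  rw [nil_append, lmul_one]
  exact append_inv _

theorem loop_inv {x y : V} (p : 𝔸.Path x y) : loop P p.inv = (loop P p)⁻¹ := by
  refine eq_inv_of_mul_eq_one_left ?_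
  rw [← loop_append, loop_congr P (inv_append p), loop_nil_one]

theorem loop_smul {x y : V} (p : 𝔸.Path x y) :
    loop P p • TreeVertex.mk (P y) = TreeVertex.mk ((P x).append p) := by
  refine TreeVertex.mk_eq_of_homotopic
    (p := ((P x).append (p.append (P y).inv)).append (P y)) ?_
  simp only [append_assoc]
  refine (Homotopic.refl _).append ?_
  simpa [append_nil_one] using (Homotopic.refl p).append (inv_append (P y))

theorem exists_eq_loop (g : FundamentalGroup 𝔸 v₀) (x y : V) :
    ∃ p : 𝔸.Path x y, g = loop P p := by
  obtain ⟨q⟩ := g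
  refine ⟨(P x).inv.append (q.append (P y)), FundamentalGroup.mk_eq ?_⟩
  simp only [append_assoc]
  rw [← append_assoc]
  have h := (append_inv (P x)).append ((Homotopic.refl q).append (append_inv (P y)))
  rw [append_nil_one, nil_append, lmul_one] at h
  exact h.symm

theorem loop_nil_smul {x : V} (b : 𝔸.vertexGroup x) :
    loop P (nil b) • TreeVertex.mk (P x) = TreeVertex.mk (P x) := by
  rw [loop_smul, TreeVertex.mk_append_nil]

/-- Write `g` as the loop of some `p` from `x` to `x`; fixing the vertex means `P x · p ∼ P x · b`,
and `P x` cancels. -/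
theorem exists_eq_loop_nil {x : V} {g : FundamentalGroup 𝔸 v₀}
    (h : g • TreeVertex.mk (P x) = TreeVertex.mk (P x)) : ∃ b : 𝔸.vertexGroup x,
    g = loop P (nil b) := by
  obtain ⟨p, rfl⟩ := exists_eq_loop P g x x
  rw [loop_smul, TreeVertex.mk_eq_mk_iff_homotopic] at h
  obtain ⟨b, h⟩ := h
  exact ⟨b, loop_congr P h.append_left_cancel⟩

/-- Paths with one edge are reduced, so uniqueness of the first edge applies: neighbours of a vertex
correspond to edges `e` with cosets of `α_e(A_e)`. -/
theorem star_eq_of_mk_append_eq {x y y' : V} {q : 𝔸.Path v₀ x} {a a' : 𝔸.vertexGroup x}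
    {e : x ⟶ y} {e' : x ⟶ y'}
    (h : TreeVertex.mk (q.append (cons a e (nil 1))) =
      TreeVertex.mk (q.append (cons a' e' (nil 1)))) :
    (⟨y, e⟩ : Quiver.Star x) = ⟨y', e'⟩ ∧ ∃ c, a' = a * 𝔸.α e c := by
  obtain ⟨r, hr, h⟩ := TreeVertex.mk_eq_mk_iff.1 h
  rw [append_assoc] at h
  have h := h.append_left_cancel.symm
  rw [cons_append] at h
  exact h.star_eq_of_cons (isReduced_of_length_le_one (by simp [length, length_append, hr]))
    (isReduced_of_length_le_one (by simp [length]))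

theorem smul_smul_mk_edge {x y : V} (b : 𝔸.vertexGroup x) (e : x ⟶ y) :
    loop P (nil b) • loop P (cons 1 e (nil 1)) • TreeVertex.mk (P y) =
      TreeVertex.mk ((P x).append (cons b e (nil 1))) := by
  rw [smul_smul, ← loop_append, loop_smul, nil_append, lmul_cons, mul_one]

theorem loop_α_smul_edge {x y : V} (e : x ⟶ y) (c : 𝔸.edgeGroup e) :
    loop P (nil (𝔸.α e c)) • loop P (cons 1 e (nil 1)) • TreeVertex.mk (P y) =
      loop P (cons 1 e (nil 1)) • TreeVertex.mk (P y) := by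
  rw [smul_smul_mk_edge, loop_smul, TreeVertex.mk_eq_mk_iff_homotopic]
  refine ⟨𝔸.ω e c, ?_⟩
  rw [append_assoc]
  refine (Homotopic.refl _).append ?_
  simpa [cons_append, nil_append, lmul_nil] using homotopic_cons_mul_α 1 e c (nil 1)

theorem exists_eq_loop_α {x y : V} {e : x ⟶ y} {g : FundamentalGroup 𝔸 v₀}
    (h : g • TreeVertex.mk (P x) = TreeVertex.mk (P x))
    (h' : g • loop P (cons 1 e (nil 1)) • TreeVertex.mk (P y) =
      loop P (cons 1 e (nil 1)) • TreeVertex.mk (P y)) :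
    ∃ c, g = loop P (nil (𝔸.α e c)) := by
  obtain ⟨b, rfl⟩ := exists_eq_loop_nil P h
  rw [smul_smul_mk_edge, loop_smul] at h'
  obtain ⟨-, c, rfl⟩ := star_eq_of_mk_append_eq h'.symm
  exact ⟨c, by rw [one_mul]⟩

theorem loop_ω {x y : V} (e : x ⟶ y) (c : 𝔸.edgeGroup e) :
    loop P (nil (𝔸.ω e c)) = (loop P (cons 1 e (nil 1)))⁻¹ * loop P (nil (𝔸.α e c)) *
      loop P (cons 1 e (nil 1)) := by
  rw [mul_assoc, eq_inv_mul_iff_mul_eq, ← loop_append, ← loop_append]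
  refine loop_congr P ?_
  have h := (homotopic_cons_mul_α 1 e c (nil 1)).symm
  simpa only [cons_append, nil_append, lmul_nil, lmul_cons, one_mul, mul_one] using h

theorem loop_reverse {x y : V} (e : x ⟶ y) :
    loop P (cons 1 (Quiver.reverse e) (nil 1)) = (loop P (cons 1 e (nil 1)))⁻¹ := by
  rw [← loop_inv]
  simp [inv, nil_append, lmul_cons]

/-- The homomorphism `b ↦ loop P (nil b)`. -/
def loopHom (x : V) : 𝔸.vertexGroup x →* FundamentalGroup 𝔸 v₀ where
  toFun b := loop P (nil b)
  map_one' := loop_nil_one P x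
  map_mul' a b := loop_append P (nil a) (nil b)

theorem loopHom_injective (x : V) : Function.Injective (loopHom P x) :=
  fun _ _ h => (homotopic_of_loop_eq P h).eq_of_nil

theorem loop_eq_mk (h : P v₀ = nil 1) (p : 𝔸.Path v₀ v₀) : loop P p = FundamentalGroup.mk p := by
  simp [loop, h, inv, append_nil_one, nil_append, lmul_one]

theorem eval_loop {x y : V} (p : 𝔸.Path x y) :
    p.eval (fun e => loop P (cons 1 e (nil 1))) (loopHom P) = loop P p := by
  induction p with
  | nil b => rfl
  | cons b e p ih =>
    rw [Path.eval, ih]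
    change loop P (nil b) * _ * _ = _
    rw [← loop_append, ← loop_append]
    simp [nil_append, lmul_cons, cons_append, lmul_one]

end Loop

theorem Path.map_eval {U U' : Type*} [Group U] [Group U'] (κ : U →* U')
    (γ : ∀ {x y : V}, (x ⟶ y) → U) (ψ : ∀ z : V, 𝔸.vertexGroup z →* U) {x y : V}
    (p : 𝔸.Path x y) :
    κ (p.eval γ ψ) = p.eval (fun e => κ (γ e)) (fun z => κ.comp (ψ z)) := by
  induction p with
  | nil b => rfl
  | cons b e p ih => simp [Path.eval, ih]

/-- The path along the edges of a subgraph, with trivial group elements. -/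
def Path.ofSubquiver (𝔸 : GraphOfGroups.{u, v, w₁, w₂} V) (T : WideSubquiver V) {x y : V}
    (p : Quiver.Path (V := T) x y) : 𝔸.Path x y :=
  Quiver.Path.rec (V := T) (motive := fun z _ => 𝔸.Path x z) (nil (1 : 𝔸.vertexGroup x))
    (fun {y z : V} _ (e : {e : y ⟶ z // e ∈ T y z}) q => q.append (cons 1 e.1 (nil 1))) p

/-- `P z` follows the unique path in a geodesic subtree. Extending the path to `x` by a tree edge
gives the path to `y`, so tree edges will have trivial loops. -/
theorem exists_spanning_tree_paths (𝔸 : GraphOfGroups.{u, v, w₁, w₂} V)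
    (h : Quiver.IsStronglyConnected V) (v₀ : V) :
    ∃ (T : WideSubquiver V) (P : ∀ z, 𝔸.Path v₀ z), Nonempty (Quiver.Arborescence T) ∧
      P v₀ = nil 1 ∧
      ∀ {x y : V} (e : x ⟶ y), e ∈ T x y → P y = (P x).append (cons 1 e (nil 1)) := by
  have : Quiver.RootedConnected v₀ := ⟨fun z => h v₀ z⟩
  let T := Quiver.geodesicSubtree v₀
  let A : Quiver.Arborescence T := Quiver.geodesicArborescence v₀
  let Q : ∀ z : T, Quiver.Path (V := T) v₀ z := fun z => (A.uniquePath z).default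
  have hQ : ∀ (z : T) (p : Quiver.Path (V := T) v₀ z), Q z = p := fun z p =>
    ((A.uniquePath z).uniq p).symm
  refine ⟨T, fun z => Path.ofSubquiver 𝔸 T (Q z), ⟨A⟩, ?_, ?_⟩
  · change Path.ofSubquiver 𝔸 T (Q v₀) = _
    rw [hQ v₀ .nil]
    rfl
  · intro x y e he
    change Path.ofSubquiver 𝔸 T (Q y) = _
    rw [hQ y (.cons (Q x) ⟨e, he⟩)]
    rfl

end GraphOfGroups

namespace SimpleGraph

/-- The image of a graph under an injective homomorphism is isomorphic to the graph. -/
noncomputable def isoMapTop {W : Type*} {W' : Type*} {G : SimpleGraph W} {H : SimpleGraph W'}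
    (f : G →g H) (hf : Function.Injective f) : G ≃g ((⊤ : G.Subgraph).map f).coe where
  toEquiv := (Equiv.Set.univ W).symm.trans (Equiv.Set.image f Set.univ hf)
  map_rel_iff' {s t} := by
    change Relation.Map G.Adj f f (f s) (f t) ↔ _
    exact Relation.map_apply_apply hf hf _ _ _

end SimpleGraph

/-! ### The induced splitting. -/

namespace AGraph

variable {V : Type u} [SerreGraph.{u, v} V] {𝔸 : GraphOfGroups.{u, v, w₁, w₂} V}
  {B : Type u'} [SerreGraph.{u', v'} B] {𝓑 : AGraph 𝔸 B} {u₀ : B}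

theorem rangeRestrict_smul_φ (g : FundamentalGroup 𝓑.graphOfGroups u₀)
    (s : TreeVertex 𝓑.graphOfGroups u₀) :
    (𝓑.ν u₀).rangeRestrict g • 𝓑.φ u₀ s = 𝓑.φ u₀ (g • s) :=
  (𝓑.φ_smul u₀ g s).symm

/-- Injectivity of `φ` moves stabilizer computations into the tree of `𝔹`. -/
theorem IsFolded.mem_stabilizer_φ_iff (h : 𝓑.IsFolded)
    {g : FundamentalGroup 𝓑.graphOfGroups u₀} {s : TreeVertex 𝓑.graphOfGroups u₀} :
    (𝓑.ν u₀).rangeRestrict g ∈ MulAction.stabilizer (𝓑.ν u₀).range (𝓑.φ u₀ s) ↔ g • s = s := by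
  rw [MulAction.mem_stabilizer_iff, rangeRestrict_smul_φ, (h.φ_injective u₀).eq_iff]

theorem IsFolded.rangeRestrict_bijective (h : 𝓑.IsFolded) (u₀ : B) :
    Function.Bijective (𝓑.ν u₀).rangeRestrict :=
  ⟨fun _ _ hg => h.ν_injective u₀ (congrArg Subtype.val hg), (𝓑.ν u₀).rangeRestrict_surjective⟩

section

variable (P : ∀ z, 𝓑.graphOfGroups.Path u₀ z)

/-- The isomorphism of a vertex group with the stabilizer of a lifted vertex. -/
noncomputable def IsFolded.vertexStabilizerEquiv (h : 𝓑.IsFolded) (z : B) :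
    𝓑.graphOfGroups.vertexGroup z ≃*
      MulAction.stabilizer (𝓑.ν u₀).range (𝓑.φ u₀ (TreeVertex.mk (P z))) :=
  MulEquiv.ofBijective
    (((𝓑.ν u₀).rangeRestrict.comp (loopHom P z)).codRestrict
      (MulAction.stabilizer (𝓑.ν u₀).range (𝓑.φ u₀ (TreeVertex.mk (P z))))
      fun b => h.mem_stabilizer_φ_iff.2 (loop_nil_smul P b)) <| by
    constructor
    · intro b b' hb
      exact loopHom_injective P z ((h.rangeRestrict_bijective u₀).1 (congrArg Subtype.val hb))
    · rintro ⟨g, hg⟩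
      obtain ⟨g, rfl⟩ := (h.rangeRestrict_bijective u₀).2 g
      obtain ⟨b, rfl⟩ := exists_eq_loop_nil P (h.mem_stabilizer_φ_iff.1 hg)
      exact ⟨b, rfl⟩

/-- The isomorphism of an edge group with the stabilizer of a lifted edge. -/
noncomputable def IsFolded.edgeStabilizerEquiv (h : 𝓑.IsFolded) {x y : B} (f : x ⟶ y) :
    𝓑.graphOfGroups.edgeGroup f ≃*
      (MulAction.stabilizer (𝓑.ν u₀).range (𝓑.φ u₀ (TreeVertex.mk (P x))) ⊓
        MulAction.stabilizer (𝓑.ν u₀).range ((𝓑.ν u₀).rangeRestrict (loop P (cons 1 f (nil 1))) •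
          𝓑.φ u₀ (TreeVertex.mk (P y))) : Subgroup (𝓑.ν u₀).range) :=
  MulEquiv.ofBijective
    (((𝓑.ν u₀).rangeRestrict.comp ((loopHom P x).comp (𝓑.graphOfGroups.α f))).codRestrict
      (MulAction.stabilizer (𝓑.ν u₀).range (𝓑.φ u₀ (TreeVertex.mk (P x))) ⊓
        MulAction.stabilizer (𝓑.ν u₀).range ((𝓑.ν u₀).rangeRestrict (loop P (cons 1 f (nil 1))) •
          𝓑.φ u₀ (TreeVertex.mk (P y))))
      fun c => ⟨h.mem_stabilizer_φ_iff.2 (loop_nil_smul P _), by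
        rw [rangeRestrict_smul_φ]
        exact h.mem_stabilizer_φ_iff.2 (loop_α_smul_edge P f c)⟩) <| by
    constructor
    · intro c c' hc
      exact 𝓑.graphOfGroups.α_injective f (loopHom_injective P x
        ((h.rangeRestrict_bijective u₀).1 (congrArg Subtype.val hc)))
    · rintro ⟨g, hg, hg'⟩
      obtain ⟨g, rfl⟩ := (h.rangeRestrict_bijective u₀).2 g
      rw [rangeRestrict_smul_φ] at hg'
      obtain ⟨c, rfl⟩ := exists_eq_loop_α P (h.mem_stabilizer_φ_iff.1 hg)
        (h.mem_stabilizer_φ_iff.1 hg')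
      exact ⟨c, rfl⟩

end

theorem IsFolded.existsUnique_vertex (h : 𝓑.IsFolded) {P : ∀ z, 𝓑.graphOfGroups.Path u₀ z}
    (hP : P u₀ = nil 1) (s : TreeVertex 𝓑.graphOfGroups u₀) :
    ∃! z : B, ∃ g : (𝓑.ν u₀).range, g • 𝓑.φ u₀ (TreeVertex.mk (P z)) = 𝓑.φ u₀ s := by
  obtain ⟨z, p, rfl⟩ := s.exists_rep
  refine ⟨z, ⟨(𝓑.ν u₀).rangeRestrict (loop P p), ?_⟩, ?_⟩
  · rw [rangeRestrict_smul_φ, loop_smul, hP, nil_append, lmul_one]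
  · rintro z' ⟨g, hg⟩
    obtain ⟨g, rfl⟩ := (h.rangeRestrict_bijective u₀).2 g
    rw [rangeRestrict_smul_φ] at hg
    -- The action preserves the end vertex in `B` of a representing path.
    exact congrArg Sigma.fst (h.φ_injective u₀ hg)

theorem IsFolded.existsUnique_edge (h : 𝓑.IsFolded) {P : ∀ z, 𝓑.graphOfGroups.Path u₀ z}
    (hP : P u₀ = nil 1) {s t : TreeVertex 𝓑.graphOfGroups u₀} (hst : TreeVertex.Adj s t) :
    ∃! f : Quiver.Total B, ∃ g : (𝓑.ν u₀).range,
      g • 𝓑.φ u₀ (TreeVertex.mk (P f.left)) = 𝓑.φ u₀ s ∧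
      g • (𝓑.ν u₀).rangeRestrict (loop P (cons 1 f.hom (nil 1))) •
        𝓑.φ u₀ (TreeVertex.mk (P f.right)) = 𝓑.φ u₀ t := by
  obtain ⟨x, y, p, b, f, rfl, rfl⟩ := hst
  have key : ∃ g : FundamentalGroup 𝓑.graphOfGroups u₀,
      g • TreeVertex.mk (P x) = TreeVertex.mk p ∧
      g • loop P (cons 1 f (nil 1)) • TreeVertex.mk (P y) =
        TreeVertex.mk (p.append (cons b f (nil 1))) := by
    refine ⟨loop P (p.append (nil b)), ?_, ?_⟩
    · rw [loop_smul, hP, nil_append, lmul_one, TreeVertex.mk_append_nil]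
    · rw [smul_smul, ← loop_append, loop_smul, hP, nil_append, lmul_one, append_assoc, nil_append,
        lmul_cons, mul_one]
  obtain ⟨g, hs, ht⟩ := key
  refine ⟨⟨x, y, f⟩, ⟨(𝓑.ν u₀).rangeRestrict g, ?_, ?_⟩, ?_⟩
  · rw [rangeRestrict_smul_φ, hs]
  · rw [rangeRestrict_smul_φ, rangeRestrict_smul_φ, ht]
  · rintro ⟨x', y', f'⟩ ⟨g', hs', ht'⟩
    obtain ⟨g', rfl⟩ := (h.rangeRestrict_bijective u₀).2 g'
    dsimp only at hs' ht'
    rw [rangeRestrict_smul_φ] at hs'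
    rw [rangeRestrict_smul_φ, rangeRestrict_smul_φ] at ht'
    have hs' := (h.φ_injective u₀ hs').trans hs.symm
    have ht' := (h.φ_injective u₀ ht').trans ht.symm
    obtain rfl : x' = x := congrArg Sigma.fst hs'
    -- Now `g⁻¹ * g'` fixes the lift of `x`, so it comes from some `b'` in the vertex group, and
    -- comparing the neighbours determines the edge.
    rw [← inv_smul_eq_iff, smul_smul] at hs' ht'
    obtain ⟨b', hb'⟩ := exists_eq_loop_nil P hs'
    rw [hb', smul_smul_mk_edge, loop_smul] at ht'
    obtain ⟨hf, -⟩ := star_eq_of_mk_append_eq ht'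
    cases hf
    rfl

/-- A folded graph with connected underlying graph is an induced splitting. -/
theorem IsFolded.nonempty_inducedSplitting (h : 𝓑.IsFolded)
    (hconn : Quiver.IsStronglyConnected B) (u₀ : B) :
    Nonempty (InducedSplitting (𝓑.ν u₀).range ((⊤ : (tree _ u₀).Subgraph).map (𝓑.φ u₀))
      𝓑.graphOfGroups u₀ (𝓑.ν u₀).rangeRestrict) := by
  obtain ⟨T, P, hT, hP, hPT⟩ := exists_spanning_tree_paths 𝓑.graphOfGroups hconn u₀
  have hsurj := (h.rangeRestrict_bijective u₀).2
  refine ⟨{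
    base_mem := ⟨TreeVertex.base _ u₀, trivial, rfl⟩
    smul_mem := ?_
    smul_adj := ?_
    -- `Y` is an isomorphic copy of the Bass–Serre tree of `𝔹`.
    isTree := (SimpleGraph.isoMapTop _ (h.φ_injective u₀)).isTree_iff.1 (tree_isTree _ u₀)
    vLift := fun z => 𝓑.φ u₀ (TreeVertex.mk (P z))
    vLift_mem := fun z => ⟨_, trivial, rfl⟩
    vLift_base := by rw [hP]; rfl
    vertex_orbits := ?_
    γ := fun f => (𝓑.ν u₀).rangeRestrict (loop P (cons 1 f (nil 1)))
    γ_reverse := fun f => by rw [loop_reverse, map_inv]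
    edge_adj := ?_
    edge_orbits := ?_
    maxTree := T
    maxTree_isTree := hT
    γ_maxTree := ?_
    ψ := h.vertexStabilizerEquiv P
    ψEdge := h.edgeStabilizerEquiv P
    ψ_α := fun f c => rfl
    ψ_ω := fun f c => ?_
    κ_bijective := h.rangeRestrict_bijective u₀
    κ_mk := fun p => ?_ }⟩
  · rintro g _ ⟨s, -, rfl⟩
    obtain ⟨g, rfl⟩ := hsurj g
    exact ⟨g • s, trivial, (rangeRestrict_smul_φ g s).symm⟩
  · rintro g _ _ ⟨s, t, hst, rfl, rfl⟩
    obtain ⟨g, rfl⟩ := hsurj g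
    exact ⟨g • s, g • t, TreeVertex.Adj.smul g hst, (rangeRestrict_smul_φ g s).symm,
      (rangeRestrict_smul_φ g t).symm⟩
  · rintro _ ⟨s, -, rfl⟩
    exact h.existsUnique_vertex hP s
  · intro x y f
    rw [rangeRestrict_smul_φ, loop_smul]
    exact ⟨_, _, TreeVertex.adj_mk_append (P x) 1 f 1, rfl, rfl⟩
  · rintro _ _ ⟨s, t, hst, rfl, rfl⟩
    exact h.existsUnique_edge hP hst
  · intro x y f hf
    have hl : loop P (cons 1 f (nil 1)) = 1 := by
      refine (FundamentalGroup.mk_eq ?_ : _ = FundamentalGroup.mk (𝔸 := 𝓑.graphOfGroups) (nil 1))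
      -- For a tree edge, `P x` followed by `f` is `P y`, which cancels against its inverse.
      rw [← append_assoc, ← hPT f hf]
      exact append_inv _
    rw [hl, map_one]
  · refine (congrArg (𝓑.ν u₀).rangeRestrict (loop_ω P f c)).trans ?_
    simp only [map_mul, map_inv]
    rfl
  -- As `P u₀` is trivial, the class of `p` is `loop P p`, which is a product over the elements and
  -- edges of `p`.
  · rw [← loop_eq_mk P hP, ← eval_loop, map_eval]
    rfl

end AGraph

theorem mainTheorem4 {V : Type u} [SerreGraph.{u, v} V] {B : Type u'} [SerreGraph.{u', v'} B]
    (𝔸 : GraphOfGroups.{u, v, w₁, w₂} V) (𝓑 : AGraph 𝔸 B) (h𝓑 : 𝓑.IsFolded) (u₀ : B) :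
    FundamentalGroup.mk '' 𝓑.language u₀ = ((𝓑.ν u₀).range : Set (FundamentalGroup 𝔸 _)) ∧
    Function.Injective (𝓑.ν u₀) ∧
    Function.Bijective (𝓑.ν u₀).rangeRestrict ∧
    𝓑.φ u₀ (TreeVertex.base _ u₀) = TreeVertex.base 𝔸 (𝓑.type.obj u₀) ∧
    (∀ (g : FundamentalGroup 𝓑.graphOfGroups u₀) (s : TreeVertex 𝓑.graphOfGroups u₀),
      𝓑.φ u₀ (g • s) = 𝓑.ν u₀ g • 𝓑.φ u₀ s) ∧
    Function.Injective (𝓑.φ u₀) ∧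
    (Quiver.IsStronglyConnected B →
      Nonempty (InducedSplitting (𝓑.ν u₀).range ((⊤ : (tree _ u₀).Subgraph).map (𝓑.φ u₀))
        𝓑.graphOfGroups u₀ (𝓑.ν u₀).rangeRestrict)) :=
  ⟨𝓑.image_language u₀, h𝓑.ν_injective u₀, h𝓑.rangeRestrict_bijective u₀, rfl, 𝓑.φ_smul u₀,
    h𝓑.φ_injective u₀, fun hconn => h𝓑.nonempty_inducedSplitting hconn u₀⟩
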